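/- **Setting.** Let $\mathcal H$ be an infinite-dimensional separable real Hilbert space (for instance $L^2[0,1]$) and write $a\otimes b$ for the operator $\zeta\mapsto\langle a,\zeta\rangle b$. Let $y_t,x_t,z_t,u_t,v_t$ ($t\ge 1$) be random elements of $\mathcal H$ on a probability space, with $y_t,x_t,z_t$ of mean zero, and let $\mathcal A,\mathcal B$ be bounded linear operators on $\mathcal H$. Put $\mathcal C_{zz}=\mathbb E[z_t\otimes z_t]$, $\mathcal C_{xz}=\mathbb E[x_t\otimes z_t]$, $\mathcal C_{uz}=\mathbb E[u_t\otimes z_t]$, $\mathcal C_{uu}=\mathbb E[u_t\otimes u_t]$, $\widehat{\mathcal C}_{ab}=T^{-1}\sum_{t=1}^T a_t\otimes b_t$, and $\mathcal Q=\mathcal C_{xz}^*\mathcal C_{zz}^{-1}\mathcal C_{xz}=\sum_{j}\mu_j^{-1}(\mathcal C_{xz}^*g_j)\otimes(\mathcal C_{xz}^*g_j)$, where $\mathcal C_{zz}=\sum_j\mu_j\,g_j\otimes g_j$ and $\mathcal Q=\sum_j\nu_j\,h_j\otimes h_j$ are the spectral decompositions with eigenvalues in nonincreasing order. **Assumption 3.**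 (a) $y_t=\mathcal Ax_t+u_t$ with $\mathbb E[x_t\otimes u_t]\ne0$ and $\mathbb E[u_t]=0$; $x_t=\mathcal Bz_t+v_t$ with $\mathbb E[z_t\otimes v_t]=0$ and $\mathbb E[v_t]=0$; $(x_t,z_t)_{t\ge1}$ is strictly stationary and geometrically strongly mixing, with $\mathbb E\|x_t\|^2<\infty$, $\mathbb E\|z_t\|^2<\infty$; with $\mathfrak F_{t-1}=\sigma(z_1,\dots,z_t,u_1,\dots,u_{t-1})$, $\mathbb E\|u_t\|^2<\infty$, $\mathbb E[u_t\mid\mathfrak F_{t-1}]=0$, $\mathbb E[u_t\otimes u_t\mid\mathfrak F_{t-1}]=\mathcal C_{uu}$, and, for some $\delta>0$, $\mathbb E[\|u_t\|^{2+\delta}\mid\mathfrak F_{t-1}]<\infty$ a.s. for every $t$. (b) $\ker\mathcal Q=\{0\}$ and $\mathcal A$ is Hilbert–Schmidt. (c) $\mu_1>\mu_2>\dots>0$ and $\nu_1>\nu_2>\dots>0$. (d) $\|\widehat{\mathcal C}_{xz}-\mathcal C_{xz}\|_{HS}$, $\|\widehat{\mathcal C}_{zz}-\mathcal C_{zz}\|_{HS}$,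 $\|\widehat{\mathcal C}_{uz}-\mathcal C_{uz}\|_{HS}$ and $\|\widehat{\mathcal C}_{vz}\|_{HS}$ are $O_p(T^{-1/2})$, and $\|\widehat{\mathcal C}_{uu}-\mathcal C_{uu}\|_{HS}=o_p(1)$. **Estimator.** Let $\alpha_1=\alpha_1(T)>0$ and $\alpha_2=\alpha_2(T)>0$ be deterministic. For a compact nonnegative self-adjoint operator $\mathcal S=\sum_j s_j\,e_j\otimes e_j$ with $s_1\ge s_2\ge\dots\ge0$, and $K$ not exceeding the number of positive $s_j$, let $\mathcal S_K^{-1}=\sum_{j\le K}s_j^{-1}e_j\otimes e_j$. Let $\hat\mu_j$ be the ordered eigenvalues of $\widehat{\mathcal C}_{zz}$, $K_1=\#\{j:\hat\mu_j^2>\alpha_1\}$, $\widehat{\mathcal P}=\widehat{\mathcal C}_{yz}^*(\widehat{\mathcal C}_{zz})_{K_1}^{-1}\widehat{\mathcal C}_{xz}$, $\widehat{\mathcal Q}=\widehat{\mathcal C}_{xz}^*(\widehat{\mathcal C}_{zz})_{K_1}^{-1}\widehat{\mathcal C}_{xz}$, let $\hat\nu_j,\hat h_j$ be the ordered eigenvalues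 and orthonormal eigenvectors of $\widehat{\mathcal Q}$, $K_2=\#\{j:\hat\nu_j^2>\alpha_2\}$, $\widetilde{\mathcal A}=\widehat{\mathcal P}\,\widehat{\mathcal Q}_{K_2}^{-1}$ (the functional two-stage least square estimator, F2SLSE) and $\widetilde\Pi_{K_2}=\sum_{j\le K_2}\hat h_j\otimes\hat h_j$. Let $\tau_{1,j}=2\sqrt2\max\{(\mu_{j-1}-\mu_j)^{-1},(\mu_j-\mu_{j+1})^{-1}\}$ and $\tau_{2,j}=2\sqrt2\max\{(\nu_{j-1}-\nu_j)^{-1},(\nu_j-\nu_{j+1})^{-1}\}$, the term with index $j-1=0$ being absent when $j=1$. **Theorem 5.** Suppose that Assumption 3 holds and that, as $T\to\infty$, $\alpha_1\to0$, $\alpha_2\to0$, $\alpha_1\alpha_2^{-1}\to0$, $T^{-1}\alpha_1^{-1}\to0$, $$T^{-1/2}\Big(\sum_{j=1}^{K_1}\mu_j\tau_{1,j}\Big)\Big(\sum_{j=1}^{K_2}\tau_{2,j}\Big)\overset{p}{\to}0\quad\text{and}\quad\Big(\sum_{j=K_1+1}^\infty\mu_j\Big)\Big(\sum_{j=1}^{K_2}\tau_{2,j}\Big)\overset{p}{\to}0.$$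 Then $$\|\widetilde{\mathcal A}-\mathcal A\widetilde\Pi_{K_2}\|_{op}^2=O_p(T^{-1}\alpha_1^{-1/2}\alpha_2^{-1/2})\quad\text{and}\quad\|\mathcal A(\mathcal I-\widetilde\Pi_{K_2})\|_{op}^2=o_p(1).$$ Consequently the F2SLSE is weakly consistent: $\|\widetilde{\mathcal A}-\mathcal A\|_{op}\overset{p}{\to}0$. -/

import Mathlib

open MeasureTheory Filter Topology
open scoped ENNReal

noncomputable section

namespace F2SLS

/-! ### Operators on a real Hilbert space -/

section Operators

variable {H : Type*} [NormedAddCommGroup H] [InnerProductSpace ℝ H]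

/-- The tensor product `a ⊗ b`, that is the rank-one operator `ζ ↦ ⟨a, ζ⟩ b`. -/
def tensor (a b : H) : H →L[ℝ] H := InnerProductSpace.rankOne ℝ b a

/-- `(a, e)` is a system of ordered eigenelements of `S`: the `e j` are orthonormal, the `a j` are
nonnegative and nonincreasing (so eigenvalues are repeated according to multiplicity), and
`S = ∑ j, a j • (e j ⊗ e j)`, the series converging in operator norm.
The index `j : ℕ` stands for the eigenelement of rank `j + 1`. -/
structure IsEigenSystem (S : H →L[ℝ] H) (a : ℕ → ℝ) (e : ℕ → H) : Prop where
  orthonormal : Orthonormal ℝ e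
  nonneg : ∀ j, 0 ≤ a j
  antitone : Antitone a
  tendsto : Tendsto (fun n => ∑ j ∈ Finset.range n, a j • tensor (e j) (e j)) atTop (𝓝 S)

section Existence

variable [CompleteSpace H]

/-- A nonzero compact nonnegative operator attains its norm as an eigenvalue. -/
theorem exists_unit_eigenvector (S : H →L[ℝ] H) (hc : IsCompactOperator S) (hp : S.IsPositive)
    (h0 : S ≠ 0) : ∃ e : H, ‖e‖ = 1 ∧ S e = ‖S‖ • e := by
  have hnt : Nontrivial H := by
    by_contra h
    rw [not_nontrivial_iff_subsingleton] at h
    exact h0 (ContinuousLinearMap.ext fun x => Subsingleton.elim _ _)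
  have hS : ‖S‖ ≠ 0 := norm_ne_zero_iff.mpr h0
  have hspec : algebraMap ℝ ℝ ‖S‖ ∈ spectrum ℝ S := by
    by_contra hcon
    have hres : algebraMap ℝ ℝ ‖S‖ ∈ resolventSet ℝ S := by
      simpa [spectrum] using hcon
    obtain ⟨ε, hε, hb⟩ := S.rayleighQuotient_le_of_norm_mem_resolventSet hres
    have h1 := S.norm_eq_iSup_rayleighQuotient hp.isSymmetric
    have h2 : (⨆ x, |S.rayleighQuotient x|) ≤ ‖S‖ - ε := by
      refine ciSup_le fun x => ?_
      rw [abs_of_nonneg]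
      · exact hb x
      · rw [ContinuousLinearMap.rayleighQuotient]
        have := hp.re_inner_nonneg_left x
        simp only [ContinuousLinearMap.reApplyInnerSelf_apply]
        positivity
    linarith
  have hev : Module.End.HasEigenvalue (S : Module.End ℝ H) ‖S‖ :=
    (hc.hasEigenvalue_iff_mem_spectrum hS).mpr hspec
  obtain ⟨w, hw⟩ := hev.exists_hasEigenvector
  have hw0 : ‖w‖ ≠ 0 := norm_ne_zero_iff.mpr hw.2
  refine ⟨‖w‖⁻¹ • w, ?_, ?_⟩
  · rw [norm_smul, norm_inv, norm_norm, inv_mul_cancel₀ hw0]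
  · have := hw.apply_eq_smul
    rw [map_smul, smul_comm]
    congr 1

/-- One step of the construction: off a finite-dimensional invariant subspace `V`, the norm of a
compact nonnegative operator is attained at a unit eigenvector. -/
theorem exists_next_eigenvector (hinf : ¬ FiniteDimensional ℝ H) (S : H →L[ℝ] H)
    (hc : IsCompactOperator S) (hp : S.IsPositive) (V : Submodule ℝ H)
    (hV : FiniteDimensional ℝ V) (hinv : ∀ x ∈ V, S x ∈ V) :
    ∃ (c : ℝ) (e : H), 0 ≤ c ∧ e ∈ Vᗮ ∧ ‖e‖ = 1 ∧ S e = c • e ∧ ∀ w ∈ Vᗮ, ‖S w‖ ≤ c * ‖w‖ := by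
  have hinv' : ∀ x ∈ Vᗮ, S x ∈ Vᗮ := by
    intro x hx
    rw [Submodule.mem_orthogonal] at hx ⊢
    intro u hu
    have hsym := hp.isSymmetric u x
    simp only [ContinuousLinearMap.coe_coe] at hsym
    rw [← hsym]
    exact hx _ (hinv u hu)
  let S' : Vᗮ →L[ℝ] Vᗮ := S.restrict hinv'
  have hS'c : IsCompactOperator S' := hc.restrict' hinv'
  have hS'p : S'.IsPositive := by
    refine ⟨fun x y => ?_, fun x => ?_⟩
    · exact hp.isSymmetric x y
    · exact hp.2 x
  by_cases h0 : S' = 0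
  · have hne : Vᗮ ≠ ⊥ := by
      intro h
      rw [Submodule.orthogonal_eq_bot_iff] at h
      subst h
      exact hinf (Module.Finite.equiv (Submodule.topEquiv (R := ℝ) (M := H)))
    obtain ⟨w, hw, hw0⟩ := Submodule.exists_mem_ne_zero_of_ne_bot hne
    have hz : ∀ x ∈ Vᗮ, S x = 0 := fun x hx => by
      have := congrArg (fun R : Vᗮ →L[ℝ] Vᗮ => ((R ⟨x, hx⟩ : Vᗮ) : H)) h0
      simpa [S'] using this
    refine ⟨0, ‖w‖⁻¹ • w, le_rfl, Submodule.smul_mem _ _ hw, ?_, ?_, ?_⟩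
    · rw [norm_smul, norm_inv, norm_norm, inv_mul_cancel₀ (norm_ne_zero_iff.mpr hw0)]
    · rw [hz _ (Submodule.smul_mem _ _ hw), zero_smul]
    · intro x hx
      rw [hz x hx]; simp
  · obtain ⟨e, he1, he2⟩ := exists_unit_eigenvector S' hS'c hS'p h0
    refine ⟨‖S'‖, e, norm_nonneg S', e.2, by simpa using he1, ?_, ?_⟩
    · have := congrArg (Subtype.val) he2
      simpa [S'] using this
    · intro w hw
      have := S'.le_opNorm ⟨w, hw⟩
      simpa [S'] using this

/-- Every compact nonnegative (self-adjoint) operator on an infinite-dimensional Hilbert space has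
a system of ordered eigenelements. -/
theorem exists_isEigenSystem (hinf : ¬ FiniteDimensional ℝ H) (S : H →L[ℝ] H)
    (hc : IsCompactOperator S) (hp : S.IsPositive) : ∃ a e, IsEigenSystem S a e := by
  classical
  let St := {V : Submodule ℝ H // FiniteDimensional ℝ V ∧ ∀ x ∈ V, S x ∈ V}
  have step : ∀ V : St, ∃ p : ℝ × H, 0 ≤ p.1 ∧ p.2 ∈ V.1ᗮ ∧ ‖p.2‖ = 1 ∧ S p.2 = p.1 • p.2 ∧
      ∀ w ∈ V.1ᗮ, ‖S w‖ ≤ p.1 * ‖w‖ := fun V => by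
    obtain ⟨c, e, h⟩ := exists_next_eigenvector hinf S hc hp V.1 V.2.1 V.2.2
    exact ⟨(c, e), h⟩
  choose p hp0 hpV hp1 hpS hpB using step
  let nxt : St → St := fun V => ⟨V.1 ⊔ Submodule.span ℝ {(p V).2}, by
    have := V.2.1
    refine ⟨inferInstance, fun x hx => ?_⟩
    obtain ⟨y, hy, z, hz, rfl⟩ := Submodule.mem_sup.mp hx
    obtain ⟨r, rfl⟩ := Submodule.mem_span_singleton.mp hz
    rw [map_add, map_smul, hpS]
    exact Submodule.add_mem_sup (V.2.2 y hy) (Submodule.smul_mem _ _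
      (Submodule.smul_mem _ _ (Submodule.mem_span_singleton_self _)))⟩
  let V : ℕ → St := fun n => Nat.rec (⟨⊥, inferInstance, fun x hx => by
    rw [Submodule.mem_bot] at hx; simp [hx]⟩ : St) (fun _ W => nxt W) n
  have hVs : ∀ n, (V (n + 1)).1 = (V n).1 ⊔ Submodule.span ℝ {(p (V n)).2} := fun n => rfl
  let a : ℕ → ℝ := fun n => (p (V n)).1
  let e : ℕ → H := fun n => (p (V n)).2
  have hVmono : Monotone fun n => (V n).1 :=
    monotone_nat_of_le_succ fun n => by rw [hVs]; exact le_sup_left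
  have hmem : ∀ m n, m < n → e m ∈ (V n).1 := fun m n hmn => by
    refine hVmono (Nat.succ_le_of_lt hmn) ?_
    change e m ∈ (V (m + 1)).1
    rw [hVs]
    exact Submodule.mem_sup_right (Submodule.mem_span_singleton_self _)
  have hspan : ∀ n (w : H), (∀ j < n, inner ℝ (e j) w = 0) → w ∈ (V n).1ᗮ := by
    intro n
    induction n with
    | zero =>
      intro w _
      change w ∈ (⊥ : Submodule ℝ H)ᗮ
      simp
    | succ n ih =>
      intro w hw
      rw [hVs, ← Submodule.inf_orthogonal]
      refine ⟨ih w fun j hj => hw j (Nat.lt_succ_of_lt hj), ?_⟩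
      rw [SetLike.mem_coe, Submodule.mem_orthogonal_singleton_iff_inner_right]
      exact hw n (Nat.lt_succ_self n)
  have hlt : ∀ m n, m < n → inner ℝ (e m) (e n) = 0 := fun m n hmn =>
    (Submodule.mem_orthogonal _ _).mp (hpV (V n)) _ (hmem m n hmn)
  have horth : Orthonormal ℝ e := by
    refine ⟨fun n => hp1 (V n), fun m n hmn => ?_⟩
    rcases lt_or_gt_of_ne hmn with h | h
    · exact hlt m n h
    · rw [real_inner_comm]; exact hlt n m h
  have hSe : ∀ n, S (e n) = a n • e n := fun n => hpS (V n)
  have ha0 : ∀ n, 0 ≤ a n := fun n => hp0 (V n)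
  have hanti : Antitone a := by
    refine antitone_nat_of_succ_le fun n => ?_
    have h1 := hpB (V n) (e (n + 1))
      (Submodule.orthogonal_le (hVmono (Nat.le_succ n)) (hpV (V (n + 1))))
    have h2 : ‖e (n + 1)‖ = 1 := horth.1 (n + 1)
    have h3 : ‖a (n + 1)‖ = a (n + 1) := Real.norm_of_nonneg (ha0 (n + 1))
    rw [hSe (n + 1), norm_smul, h2, mul_one, mul_one, h3] at h1
    exact h1
  have hbound : ∀ n, ‖(∑ j ∈ Finset.range n, a j • tensor (e j) (e j)) - S‖ ≤ a n := by
    intro n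
    rw [norm_sub_rev]
    refine ContinuousLinearMap.opNorm_le_bound _ (ha0 n) fun w => ?_
    set r := ∑ j ∈ Finset.range n, (inner ℝ (e j) w) • e j with hr
    have hq : ∀ j < n, inner ℝ (e j) (w - r) = 0 := by
      intro j hj
      rw [inner_sub_right, hr, inner_sum]
      simp only [inner_smul_right]
      rw [Finset.sum_eq_single j]
      · rw [real_inner_self_eq_norm_sq, horth.1]; simp
      · intro i _ hij
        rw [horth.2 hij.symm, mul_zero]
      · intro h; exact absurd (Finset.mem_range.mpr hj) h
    have happ : (S - ∑ j ∈ Finset.range n, a j • tensor (e j) (e j)) w = S (w - r) := by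
      rw [map_sub, hr, map_sum, sub_apply, sum_apply]
      congr 1
      refine Finset.sum_congr rfl fun j _ => ?_
      rw [map_smul, hSe, smul_apply, tensor,
        InnerProductSpace.rankOne_apply, smul_comm]
    have hnorm : ‖w - r‖ ≤ ‖w‖ := by
      have hz : inner ℝ (w - r) r = 0 := by
        rw [show inner ℝ (w - r) r = ∑ j ∈ Finset.range n, inner ℝ (w - r)
          ((inner ℝ (e j) w) • e j) by rw [← inner_sum]]
        refine Finset.sum_eq_zero fun j hj => ?_
        rw [inner_smul_right, real_inner_comm (e j) (w - r), hq j (Finset.mem_range.mp hj), mul_zero]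
      have := norm_add_sq_eq_norm_sq_add_norm_sq_of_inner_eq_zero _ _ hz
      rw [sub_add_cancel] at this
      nlinarith [norm_nonneg (w - r), norm_nonneg w, mul_self_nonneg ‖r‖]
    rw [happ]
    exact (hpB (V n) _ (hspan n _ hq)).trans (mul_le_mul_of_nonneg_left hnorm (ha0 n))
  have hlim : Tendsto a atTop (𝓝 0) := by
    have hconv := tendsto_atTop_ciInf hanti ⟨0, by rintro _ ⟨n, rfl⟩; exact ha0 n⟩
    set c := ⨅ n, a n with hcdef
    have hcle : ∀ n, c ≤ a n := fun n => ciInf_le ⟨0, by rintro _ ⟨n, rfl⟩; exact ha0 n⟩ n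
    have hc0 : 0 ≤ c := le_ciInf ha0
    rcases hc0.eq_or_lt with h | h
    · rw [← h] at hconv; exact hconv
    exfalso
    obtain ⟨K, hK, hK'⟩ := hc.image_closedBall_subset_compact (𝕜₁ := ℝ) (f := (S : H →ₗ[ℝ] H)) 1
    obtain ⟨y, -, ψ, hψ, hψy⟩ := hK.tendsto_subseq
      (fun n => hK' ⟨e n, by simp [horth.1], rfl⟩)
    have hcs := hψy.cauchySeq
    rw [Metric.cauchySeq_iff'] at hcs
    obtain ⟨N, hN⟩ := hcs c h
    have h1 := hN (N + 1) (Nat.le_succ N)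
    simp only [Function.comp, ContinuousLinearMap.coe_coe, hSe, dist_eq_norm] at h1
    have hne : ψ (N + 1) ≠ ψ N := fun h => by simpa using hψ.injective h
    have hz : inner ℝ (a (ψ (N + 1)) • e (ψ (N + 1))) (a (ψ N) • e (ψ N)) = 0 := by
      rw [inner_smul_left, inner_smul_right, horth.2 hne]; simp
    have h2 := norm_sub_sq_eq_norm_sq_add_norm_sq_real hz
    rw [norm_smul, norm_smul, horth.1, horth.1, Real.norm_of_nonneg (ha0 _),
      Real.norm_of_nonneg (ha0 _), mul_one, mul_one] at h2
    nlinarith [hcle (ψ (N + 1)), hcle (ψ N), ha0 (ψ N),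
      norm_nonneg (a (ψ (N + 1)) • e (ψ (N + 1)) - a (ψ N) • e (ψ N))]
  refine ⟨a, e, horth, ha0, hanti, ?_⟩
  rw [tendsto_iff_norm_sub_tendsto_zero]
  exact squeeze_zero (fun _ => norm_nonneg _) hbound hlim

end Existence

/-- The ordered eigenvalues and corresponding orthonormal eigenvectors of `S`: a system of ordered
eigenelements, which exists for every compact nonnegative operator on an infinite-dimensional
Hilbert space (`exists_isEigenSystem`). -/
def eigenSystem (S : H →L[ℝ] H) : (ℕ → ℝ) × (ℕ → H) :=
  Classical.epsilon fun p => IsEigenSystem S p.1 p.2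

/-- The eigenvalue of `S` of rank `j + 1`, in nonincreasing order. -/
def eigval (S : H →L[ℝ] H) (j : ℕ) : ℝ := (eigenSystem S).1 j

/-- The eigenvector of `S` belonging to its eigenvalue of rank `j + 1`. -/
def eigvec (S : H →L[ℝ] H) (j : ℕ) : H := (eigenSystem S).2 j

theorem isEigenSystem_eigval_eigvec [CompleteSpace H] (hinf : ¬ FiniteDimensional ℝ H)
    (S : H →L[ℝ] H) (hc : IsCompactOperator S) (hp : S.IsPositive) :
    IsEigenSystem S (eigval S) (eigvec S) := by
  obtain ⟨a, e, h⟩ := exists_isEigenSystem hinf S hc hp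
  exact Classical.epsilon_spec (p := fun p : (ℕ → ℝ) × (ℕ → H) => IsEigenSystem S p.1 p.2)
    ⟨(a, e), h⟩

/-- The number of eigenvalues of `S` (with multiplicity) whose square exceeds `α`. -/
def truncLevel (S : H →L[ℝ] H) (α : ℝ) : ℕ := Set.ncard {j : ℕ | α < eigval S j ^ 2}

/-- The regularized inverse of `S` based on its first `K` eigenelements. -/
def regInv (S : H →L[ℝ] H) (K : ℕ) : H →L[ℝ] H :=
  ∑ j ∈ Finset.range K, (eigval S j)⁻¹ • tensor (eigvec S j) (eigvec S j)

/-- The orthogonal projection onto the span of the first `K` eigenvectors of `S`. -/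
def eigProj (S : H →L[ℝ] H) (K : ℕ) : H →L[ℝ] H :=
  ∑ j ∈ Finset.range K, tensor (eigvec S j) (eigvec S j)

/-- The eigenvalue-gap constants `τ_j = 2√2 max {(a_{j-1} - a_j)⁻¹, (a_j - a_{j+1})⁻¹}`, where for
the largest eigenvalue only the gap to the next one is present. -/
def gapConst (a : ℕ → ℝ) : ℕ → ℝ
  | 0 => 2 * √2 * (a 0 - a 1)⁻¹
  | j + 1 => 2 * √2 * max (a j - a (j + 1))⁻¹ (a (j + 1) - a (j + 2))⁻¹

/-- The Hilbert-Schmidt norm, with value `∞` for an operator that is not Hilbert-Schmidt; it is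
computed in some orthonormal basis of the space. -/
def hsNorm [CompleteSpace H] (S : H →L[ℝ] H) : ℝ≥0∞ :=
  (∑' b : (exists_hilbertBasis ℝ H).choose, ‖S (b : H)‖ₑ ^ 2) ^ (1 / 2 : ℝ)

/-- The operator `C* D⁻¹ C` for a compact nonnegative `D = ∑ μ_j g_j ⊗ g_j` with (unbounded) inverse
`D⁻¹ = ∑ μ_j⁻¹ g_j ⊗ g_j`, that is `∑ μ_j⁻¹ (C* g_j) ⊗ (C* g_j)`. -/
def sandwichInv [CompleteSpace H] (D C : H →L[ℝ] H) : H →L[ℝ] H :=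
  ∑' j, (eigval D j)⁻¹ •
    tensor (ContinuousLinearMap.adjoint C (eigvec D j)) (ContinuousLinearMap.adjoint C (eigvec D j))

end Operators

/-! ### Stochastic notions -/

section Stochastic

variable {Ω : Type*} [MeasurableSpace Ω]

/-- `X_T = O_p(r_T)` as `T → ∞`, for nonnegative random quantities `X_T`. -/
def IsBigOp (P : Measure Ω) (X : ℕ → Ω → ℝ≥0∞) (r : ℕ → ℝ) : Prop :=
  ∀ ε : ℝ≥0∞, 0 < ε → ∃ M : ℝ, 0 < M ∧
    ∀ᶠ T in atTop, P {ω | ENNReal.ofReal (M * r T) < X T ω} ≤ ε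

/-- `X_T → 0` in probability as `T → ∞`, i.e. `X_T = o_p(1)`, for nonnegative random quantities
`X_T`. -/
def IsLittleOpOne (P : Measure Ω) (X : ℕ → Ω → ℝ≥0∞) : Prop :=
  ∀ ε : ℝ≥0∞, 0 < ε → Tendsto (fun T => P {ω | ε ≤ X T ω}) atTop (𝓝 0)

/-- Strict stationarity of `(X_t)_{t ≥ 1}`. -/
def IsStationary {E : Type*} [MeasurableSpace E] (P : Measure Ω) (X : ℕ → Ω → E) : Prop :=
  ∀ h : ℕ, P.map (fun ω (n : ℕ) => X (n + 1 + h) ω) = P.map (fun ω (n : ℕ) => X (n + 1) ω)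

/-- The σ-algebra generated by the `X_s` with `s ∈ I`. -/
abbrev sigmaOf {E : Type*} [MeasurableSpace E] (X : ℕ → Ω → E) (I : Set ℕ) : MeasurableSpace Ω :=
  ⨆ s ∈ I, MeasurableSpace.comap (X s) inferInstance

/-- Geometric strong mixing of `(X_t)_{t ≥ 1}`: the strong mixing coefficients satisfy
`sup_k sup {|P(F ∩ G) - P(F) P(G)| : F ∈ σ(X_s, s ≤ k), G ∈ σ(X_s, s ≥ k + h)} ≤ c ρ ^ h`. -/
def IsGeomStrongMixing {E : Type*} [MeasurableSpace E] (P : Measure Ω) (X : ℕ → Ω → E) : Prop :=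
  ∃ c ρ : ℝ, 0 < c ∧ 0 < ρ ∧ ρ < 1 ∧ ∀ k h : ℕ, 1 ≤ k → 1 ≤ h → ∀ F G : Set Ω,
    MeasurableSet[sigmaOf X (Set.Icc 1 k)] F → MeasurableSet[sigmaOf X (Set.Ici (k + h))] G →
      |P.real (F ∩ G) - P.real F * P.real G| ≤ c * ρ ^ h

variable {H : Type*} [NormedAddCommGroup H] [InnerProductSpace ℝ H]

/-- The operator `E[X ⊗ Y]`. -/
def momentOp (P : Measure Ω) (X Y : Ω → H) : H →L[ℝ] H := ∫ ω, tensor (X ω) (Y ω) ∂P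

/-- The sample operator `T⁻¹ ∑_{t=1}^T X_t ⊗ Y_t`. -/
def sampleOp (X Y : ℕ → Ω → H) (T : ℕ) (ω : Ω) : H →L[ℝ] H :=
  (T : ℝ)⁻¹ • ∑ t ∈ Finset.Icc 1 T, tensor (X t ω) (Y t ω)

/-- The information set `𝔉_{t-1} = σ({z_s}_{1 ≤ s ≤ t}, {u_s}_{1 ≤ s ≤ t-1})`. -/
abbrev pastSigma [MeasurableSpace H] (z u : ℕ → Ω → H) (t : ℕ) : MeasurableSpace Ω :=
  sigmaOf z (Set.Icc 1 t) ⊔ sigmaOf u (Set.Ico 1 t)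

/-! ### The estimator, from the observations `(y_t, x_t, z_t)`, `1 ≤ t ≤ T` -/

/-- `K₁`, the number of eigenvalues of the sample covariance of `z` with square above `α₁`. -/
def K₁ (z : ℕ → Ω → H) (α₁ : ℕ → ℝ) (T : ℕ) (ω : Ω) : ℕ :=
  truncLevel (sampleOp z z T ω) (α₁ T)

variable [CompleteSpace H]

/-- `P̂ = Ĉ_yz* (Ĉ_zz)_{K₁}⁻¹ Ĉ_xz`. -/
def hatP (y x z : ℕ → Ω → H) (α₁ : ℕ → ℝ) (T : ℕ) (ω : Ω) : H →L[ℝ] H :=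
  ContinuousLinearMap.adjoint (sampleOp y z T ω) ∘L
    regInv (sampleOp z z T ω) (K₁ z α₁ T ω) ∘L sampleOp x z T ω

/-- `Q̂ = Ĉ_xz* (Ĉ_zz)_{K₁}⁻¹ Ĉ_xz`. -/
def hatQ (x z : ℕ → Ω → H) (α₁ : ℕ → ℝ) (T : ℕ) (ω : Ω) : H →L[ℝ] H :=
  ContinuousLinearMap.adjoint (sampleOp x z T ω) ∘L
    regInv (sampleOp z z T ω) (K₁ z α₁ T ω) ∘L sampleOp x z T ω

/-- `K₂`, the number of eigenvalues of `Q̂` with square above `α₂`. -/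
def K₂ (x z : ℕ → Ω → H) (α₁ α₂ : ℕ → ℝ) (T : ℕ) (ω : Ω) : ℕ :=
  truncLevel (hatQ x z α₁ T ω) (α₂ T)

/-- The functional two-stage least square estimator `Ã = P̂ Q̂_{K₂}⁻¹`. -/
def f2slse (y x z : ℕ → Ω → H) (α₁ α₂ : ℕ → ℝ) (T : ℕ) (ω : Ω) : H →L[ℝ] H :=
  hatP y x z α₁ T ω ∘L regInv (hatQ x z α₁ T ω) (K₂ x z α₁ α₂ T ω)

/-- The orthogonal projection onto the span of the first `K₂` eigenvectors of `Q̂`. -/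
def tildeProj (x z : ℕ → Ω → H) (α₁ α₂ : ℕ → ℝ) (T : ℕ) (ω : Ω) : H →L[ℝ] H :=
  eigProj (hatQ x z α₁ T ω) (K₂ x z α₁ α₂ T ω)

/-! ### Population operators and the model -/

/-- `C_zz = E[z_t ⊗ z_t]`, which does not depend on `t` by stationarity. -/
def popCzz (P : Measure Ω) (z : ℕ → Ω → H) : H →L[ℝ] H := momentOp P (z 1) (z 1)

/-- `Q = C_xz* C_zz⁻¹ C_xz`. -/
def popQ (P : Measure Ω) (x z : ℕ → Ω → H) : H →L[ℝ] H :=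
  sandwichInv (popCzz P z) (momentOp P (x 1) (z 1))

/-- The functional linear simultaneous equation model `y_t = A x_t + u_t`, `x_t = B z_t + v_t`,
`t ≥ 1`, with instrument `z_t`, and the assumptions imposed on it. -/
structure Assumptions [MeasurableSpace H] (P : Measure Ω) (A B : H →L[ℝ] H)
    (y x z u v : ℕ → Ω → H) : Prop where
  /- `y_t, x_t, z_t, u_t, v_t` are random elements of `H`; `y_t, x_t, z_t` have mean zero -/
  measurable_y : ∀ t, 1 ≤ t → Measurable (y t)
  measurable_x : ∀ t, 1 ≤ t → Measurable (x t)
  measurable_z : ∀ t, 1 ≤ t → Measurable (z t)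
  measurable_u : ∀ t, 1 ≤ t → Measurable (u t)
  measurable_v : ∀ t, 1 ≤ t → Measurable (v t)
  mean_y : ∀ t, 1 ≤ t → ∫ ω, y t ω ∂P = 0
  mean_x : ∀ t, 1 ≤ t → ∫ ω, x t ω ∂P = 0
  mean_z : ∀ t, 1 ≤ t → ∫ ω, z t ω ∂P = 0
  /- the outcome equation, with endogenous regressor and centered error -/
  model : ∀ t, 1 ≤ t → ∀ᵐ ω ∂P, y t ω = A (x t ω) + u t ω
  endogenous : ∀ t, 1 ≤ t → momentOp P (x t) (u t) ≠ 0
  mean_u : ∀ t, 1 ≤ t → ∫ ω, u t ω ∂P = 0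
  /- weak dependence and second moments -/
  stationary : IsStationary P fun t ω => (x t ω, z t ω)
  mixing : IsGeomStrongMixing P fun t ω => (x t ω, z t ω)
  sq_integrable_x : ∀ t, 1 ≤ t → MemLp (x t) 2 P
  sq_integrable_z : ∀ t, 1 ≤ t → MemLp (z t) 2 P
  sq_integrable_u : ∀ t, 1 ≤ t → MemLp (u t) 2 P
  /- the errors are a homoscedastic martingale difference sequence; `C_uu = E[u_1 ⊗ u_1]` -/
  mart_diff : ∀ t, 1 ≤ t → P[u t | pastSigma z u t] =ᵐ[P] 0
  homoscedastic : ∀ t, 1 ≤ t →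
    P[fun ω => tensor (u t ω) (u t ω) | pastSigma z u t] =ᵐ[P] fun _ => momentOp P (u 1) (u 1)
  cond_moment : ∃ δ : ℝ, 0 < δ ∧ ∀ t, 1 ≤ t →
    ∀ᵐ ω ∂P, condLExp (pastSigma z u t) P (fun ω' => ‖u t ω'‖ₑ ^ (2 + δ)) ω < ∞
  /- the first-stage equation -/
  first_stage : ∀ t, 1 ≤ t → ∀ᵐ ω ∂P, x t ω = B (z t ω) + v t ω
  first_stage_orth : ∀ t, 1 ≤ t → momentOp P (z t) (v t) = 0
  mean_v : ∀ t, 1 ≤ t → ∫ ω, v t ω ∂P = 0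
  /- identification; `A` is Hilbert-Schmidt -/
  ker_Q : (popQ P x z).ker = ⊥
  hilbertSchmidt : hsNorm A < ∞
  /- distinct positive eigenvalues -/
  eigval_Czz : ∀ j, eigval (popCzz P z) (j + 1) < eigval (popCzz P z) j ∧ 0 < eigval (popCzz P z) j
  eigval_Q : ∀ j, eigval (popQ P x z) (j + 1) < eigval (popQ P x z) j ∧ 0 < eigval (popQ P x z) j
  /- convergence rates of the sample operators -/
  rate_xz : IsBigOp P (fun T ω => hsNorm (sampleOp x z T ω - momentOp P (x 1) (z 1)))
    fun T => (√(T : ℝ))⁻¹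
  rate_zz : IsBigOp P (fun T ω => hsNorm (sampleOp z z T ω - popCzz P z)) fun T => (√(T : ℝ))⁻¹
  rate_uz : IsBigOp P (fun T ω => hsNorm (sampleOp u z T ω - momentOp P (u 1) (z 1)))
    fun T => (√(T : ℝ))⁻¹
  rate_uu : IsLittleOpOne P fun T ω => hsNorm (sampleOp u u T ω - momentOp P (u 1) (u 1))
  rate_vz : IsBigOp P (fun T ω => hsNorm (sampleOp v z T ω)) fun T => (√(T : ℝ))⁻¹

end Stochastic

end F2SLS

end

noncomputable section

namespace F2SLS

/-! ### Algebra of rank-one operators. -/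

section TensorAlgebra

variable {H : Type*} [NormedAddCommGroup H] [InnerProductSpace ℝ H]

/-! Write `Ĉ` for `sampleOp x z`, `Û` for `sampleOp u z`, `R` for the truncated inverse of `sampleOp
z z`, and `G` for that of `Q̂ = Ĉ* R Ĉ`. Substituting the outcome equation gives the exact identity
`Ã - A Π̃ = Û* R Ĉ G`. Here `R² ≤ α₁^{-1/2} R`, so `‖R Ĉ G ζ‖² ≤ α₁^{-1/2} ⟨G ζ, Q̂ G ζ⟩ ≤ α₁^{-1/2}
α₂^{-1/2} ‖ζ‖²`, because `Q̂ G` is a projection. Exogeneity makes `‖Û‖ = O_p(T^{-1/2})`, and the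
noise rate follows (`norm_sq_noise_le`, `norm_sq_f2slse_sub_le`).

For the bias, the first-stage equation gives `Ĉ = Ĉ_zz B* + Ĉ_vz`, and in the population `Q = B C_zz
B*` (`Assumptions.popQ_eq`). Since `R` inverts `Ĉ_zz` up to a projection, `Q̂ → Q` in operator norm
(`norm_sandwich_sub_le`, `Assumptions.isLittleOpOne_hatQ_sub`). A Hilbert-Schmidt `A` is a norm
limit of operators `G' Q`, because `Q` is injective and self-adjoint (`exists_norm_sub_comp_le`).
Finally `Q (I - Π̃) = Q̂ (I - Π̃) - (Q̂ - Q)(I - Π̃)`, where the first term has norm at most `√α₂`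
(`norm_comp_id_sub_eigProj_le`). Convergence of individual eigenvectors is never needed. -/

@[simp] theorem tensor_apply (a b ζ : H) : tensor a b ζ = (inner ℝ a ζ : ℝ) • b := rfl

@[simp] theorem tensor_zero_left (b : H) : tensor 0 b = 0 := by ext ζ; simp

theorem norm_tensor (a b : H) : ‖tensor a b‖ = ‖a‖ * ‖b‖ := by
  rw [tensor, InnerProductSpace.norm_rankOne, mul_comm]

/-- The tensor product as a continuous bilinear map. -/
def tensorL : H →L[ℝ] H →L[ℝ] (H →L[ℝ] H) :=
  LinearMap.mkContinuous₂
    (LinearMap.mk₂ ℝ tensor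
      (fun a a' b => by ext ζ; simp [inner_add_left, add_smul])
      (fun c a b => by ext ζ; simp [inner_smul_left, mul_smul])
      (fun a b b' => by ext ζ; simp)
      (fun c a b => by ext ζ; simp [smul_comm c]))
    1 (fun a b => by simp [norm_tensor])

@[simp] theorem tensorL_apply (a b : H) : tensorL a b = tensor a b := rfl

theorem continuous_tensor_left (b : H) : Continuous fun a : H => tensor a b :=
  (tensorL.flip b).continuous.congr fun a => by
    rw [ContinuousLinearMap.flip_apply, tensorL_apply]

attribute [irreducible] tensorL

theorem isPositive_tensor_self (a : H) : (tensor a a).IsPositive :=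
  InnerProductSpace.isPositive_rankOne_self a

/-- The operator factors through `ℝ`, where the identity is compact. -/
theorem isCompactOperator_tensor (a b : H) : IsCompactOperator (tensor a b) := by
  have h1 : IsCompactOperator (innerSL ℝ a : H →L[ℝ] ℝ) := by
    have h : IsCompactOperator (id : ℝ → ℝ) :=
      ⟨Metric.closedBall 0 1, isCompact_closedBall 0 1, Metric.closedBall_mem_nhds 0 one_pos⟩
    exact h.comp_clm (innerSL ℝ a)
  have := h1.clm_comp (ContinuousLinearMap.toSpanSingleton ℝ b)
  exact this

variable [CompleteSpace H]

theorem tensor_comp (S : H →L[ℝ] H) (a b : H) :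
    tensor a b ∘L S = tensor (ContinuousLinearMap.adjoint S a) b := by
  ext ζ; simp [ContinuousLinearMap.adjoint_inner_left]

theorem adjoint_tensor (a b : H) : ContinuousLinearMap.adjoint (tensor a b) = tensor b a := by
  simp [tensor]

/-- The form in which a linear equation for one variable is carried over to its sample
cross-covariance operators. -/
theorem tensor_add_map_left (S : H →L[ℝ] H) (a b c : H) :
    tensor (S a + b) c = tensor a c ∘L ContinuousLinearMap.adjoint S + tensor b c := by
  rw [tensor_comp, ContinuousLinearMap.adjoint_adjoint]
  ext ζ
  simp [inner_add_left, add_smul]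

end TensorAlgebra

/-! ### Finite sums diagonal in an orthonormal system. -/

section DiagonalSums

variable {H : Type*} [NormedAddCommGroup H] [InnerProductSpace ℝ H]

theorem sum_smul_tensor_apply (e : ℕ → H) (s : Finset ℕ) (c : ℕ → ℝ) (x : H) :
    (∑ j ∈ s, c j • tensor (e j) (e j)) x = ∑ j ∈ s, (c j * inner ℝ (e j) x) • e j := by
  simp [mul_smul]

theorem norm_sq_sum_smul_tensor_apply {e : ℕ → H} (he : Orthonormal ℝ e) (s : Finset ℕ)
    (c : ℕ → ℝ) (x : H) :
    ‖(∑ j ∈ s, c j • tensor (e j) (e j)) x‖ ^ 2 = ∑ j ∈ s, c j ^ 2 * inner ℝ (e j) x ^ 2 := by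
  rw [sum_smul_tensor_apply, ← real_inner_self_eq_norm_sq, he.inner_sum]
  refine Finset.sum_congr rfl fun j _ => ?_
  simp; ring

theorem inner_sum_smul_tensor_apply (e : ℕ → H) (s : Finset ℕ) (c : ℕ → ℝ) (x : H) :
    inner ℝ x ((∑ j ∈ s, c j • tensor (e j) (e j)) x) = ∑ j ∈ s, c j * inner ℝ (e j) x ^ 2 := by
  rw [sum_smul_tensor_apply, inner_sum]
  refine Finset.sum_congr rfl fun j _ => ?_
  rw [inner_smul_right, real_inner_comm]; ring

theorem norm_sum_smul_tensor_le {e : ℕ → H} (he : Orthonormal ℝ e) (s : Finset ℕ)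
    (c : ℕ → ℝ) {M : ℝ} (hM : 0 ≤ M) (hc : ∀ j ∈ s, |c j| ≤ M) :
    ‖∑ j ∈ s, c j • tensor (e j) (e j)‖ ≤ M := by
  refine ContinuousLinearMap.opNorm_le_bound _ hM fun x => ?_
  refine le_of_sq_le_sq ?_ (by positivity)
  rw [norm_sq_sum_smul_tensor_apply he, mul_pow]
  calc ∑ j ∈ s, c j ^ 2 * inner ℝ (e j) x ^ 2 ≤ ∑ j ∈ s, M ^ 2 * inner ℝ (e j) x ^ 2 := by
        refine Finset.sum_le_sum fun j hj => ?_
        gcongr ?_ * _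
        rw [← sq_abs]
        exact pow_le_pow_left₀ (abs_nonneg _) (hc j hj) 2
    _ = M ^ 2 * ∑ j ∈ s, ‖(inner ℝ (e j) x : ℝ)‖ ^ 2 := by
        rw [Finset.mul_sum]; simp
    _ ≤ M ^ 2 * ‖x‖ ^ 2 := by
        gcongr
        exact he.sum_inner_products_le x

/-- The operator inequality `S² ≤ M S`, from `c² ≤ M c` for coefficients in `[0, M]`. It is finer
than the norm bound: it keeps a quadratic form that can later be absorbed into `Q̂`. -/
theorem norm_sq_sum_smul_tensor_apply_le {e : ℕ → H} (he : Orthonormal ℝ e) (s : Finset ℕ)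
    (c : ℕ → ℝ) {M : ℝ} (hc0 : ∀ j ∈ s, 0 ≤ c j) (hc : ∀ j ∈ s, c j ≤ M) (x : H) :
    ‖(∑ j ∈ s, c j • tensor (e j) (e j)) x‖ ^ 2 ≤
      M * inner ℝ x ((∑ j ∈ s, c j • tensor (e j) (e j)) x) := by
  rw [norm_sq_sum_smul_tensor_apply he, inner_sum_smul_tensor_apply, Finset.mul_sum]
  refine Finset.sum_le_sum fun j hj => ?_
  have h1 := mul_le_mul_of_nonneg_left (hc j hj) (hc0 j hj)
  nlinarith [sq_nonneg (inner ℝ (e j) x : ℝ)]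

end DiagonalSums

/-! ### Eigensystems, truncation levels and regularized inverses. -/

section Spectral

variable {H : Type*} [NormedAddCommGroup H] [InnerProductSpace ℝ H]
  {S : H →L[ℝ] H} {a : ℕ → ℝ} {e : ℕ → H}

/-- Consecutive partial sums differ by `a n • tensor (e n) (e n)`, whose norm is `a n`. -/
theorem IsEigenSystem.tendsto_zero (h : IsEigenSystem S a e) : Tendsto a atTop (𝓝 0) := by
  have h1 := ((tendsto_add_atTop_iff_nat 1).mpr h.tendsto).sub h.tendsto
  simp only [Finset.sum_range_succ, add_sub_cancel_left, sub_self] at h1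
  refine (tendsto_zero_iff_norm_tendsto_zero.mp h1).congr fun n => ?_
  rw [norm_smul, norm_tensor, h.orthonormal.1, Real.norm_of_nonneg (h.nonneg n)]; simp

theorem IsEigenSystem.apply_eq (h : IsEigenSystem S a e) (j : ℕ) : S (e j) = a j • e j := by
  have h1 : Tendsto (fun n => (∑ i ∈ Finset.range n, a i • tensor (e i) (e i)) (e j)) atTop
      (𝓝 (S (e j))) :=
    ((ContinuousLinearMap.apply ℝ H (e j)).continuous.tendsto S).comp h.tendsto
  refine tendsto_nhds_unique h1 (tendsto_const_nhds.congr' ?_)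
  filter_upwards [eventually_gt_atTop j] with n hn
  rw [sum_smul_tensor_apply, Finset.sum_eq_single j]
  · simp [h.orthonormal.1]
  · intro i _ hij
    simp [h.orthonormal.2 hij]
  · intro hj; exact absurd (Finset.mem_range.mpr hn) hj

/-- By monotonicity, every block of the series starting at `K` has coefficients at most `a K`; the
bound passes to the limit. -/
theorem IsEigenSystem.norm_sub_le (h : IsEigenSystem S a e) (K : ℕ) :
    ‖S - ∑ j ∈ Finset.range K, a j • tensor (e j) (e j)‖ ≤ a K := by
  have h1 := (h.tendsto.sub_const (∑ j ∈ Finset.range K, a j • tensor (e j) (e j))).norm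
  refine le_of_tendsto h1 ?_
  filter_upwards [eventually_ge_atTop K] with n hn
  rw [← Finset.sum_Ico_eq_sub _ hn]
  refine norm_sum_smul_tensor_le h.orthonormal _ _ (h.nonneg K) fun j hj => ?_
  rw [abs_of_nonneg (h.nonneg j)]
  exact h.antitone (Finset.mem_Ico.mp hj).1

/-- The truncation level of `S` cuts its ordered eigenvalues at `√α`. -/
theorem IsEigenSystem.lt_truncLevel_iff (h : IsEigenSystem S (eigval S) (eigvec S)) {α : ℝ}
    (hα : 0 < α) (j : ℕ) : j < truncLevel S α ↔ α < eigval S j ^ 2 := by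
  have hex : ∃ n, eigval S n ^ 2 ≤ α := by
    have h1 := h.tendsto_zero.pow 2
    rw [zero_pow two_ne_zero] at h1
    exact ((h1.eventually (gt_mem_nhds hα)).mono fun n hn => hn.le).exists
  classical
  have hset : {j : ℕ | α < eigval S j ^ 2} = Set.Iio (Nat.find hex) := by
    ext i
    -- Antitone nonnegative eigenvalues make the counted set an initial segment, so its cardinality
    -- is the first index where the threshold fails.
    rw [Set.mem_ofPred_eq, Set.mem_Iio, Nat.lt_find_iff]
    refine ⟨fun hi m hm => ?_, fun hi => not_le.mp (hi i le_rfl)⟩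
    exact not_le.mpr (hi.trans_le (pow_le_pow_left₀ (h.nonneg i) (h.antitone hm) 2))
  have hK : truncLevel S α = Nat.find hex := by
    rw [truncLevel, hset, ← Finset.coe_Iio, Set.ncard_coe_finset, Nat.card_Iio]
  rw [hK]
  exact (Set.ext_iff.mp hset j).symm

variable (hS : IsEigenSystem S (eigval S) (eigvec S)) {α : ℝ} (hα : 0 < α)
include hS hα

theorem sqrt_lt_eigval {j : ℕ} (hj : j < truncLevel S α) : √α < eigval S j := by
  rw [Real.sqrt_lt' ((sq_pos_iff.mp (hα.trans ((hS.lt_truncLevel_iff hα j).mp hj))).lt_of_le'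
    (hS.nonneg j))]
  exact (hS.lt_truncLevel_iff hα j).mp hj

theorem eigval_inv_le {j : ℕ} (hj : j ∈ Finset.range (truncLevel S α)) :
    (eigval S j)⁻¹ ≤ (√α)⁻¹ :=
  inv_anti₀ (Real.sqrt_pos.mpr hα) (sqrt_lt_eigval hS hα (Finset.mem_range.mp hj)).le

theorem norm_regInv_le : ‖regInv S (truncLevel S α)‖ ≤ (√α)⁻¹ :=
  norm_sum_smul_tensor_le hS.orthonormal _ _ (by positivity) fun j hj => by
    rw [abs_of_nonneg (inv_nonneg.mpr (hS.nonneg j))]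
    exact eigval_inv_le hS hα hj

/-- Using `R² ≤ α^{-1/2} R` instead of `‖R‖² ≤ α⁻¹` is what produces the mixed rate `α₁^{-1/2}
α₂^{-1/2}`. -/
theorem norm_sq_regInv_apply_le (x : H) : ‖regInv S (truncLevel S α) x‖ ^ 2 ≤
    (√α)⁻¹ * inner ℝ x (regInv S (truncLevel S α) x) :=
  norm_sq_sum_smul_tensor_apply_le hS.orthonormal _ _ (fun j _ => inv_nonneg.mpr (hS.nonneg j))
    (fun _ hj => eigval_inv_le hS hα hj) x

theorem comp_regInv : S ∘L regInv S (truncLevel S α) = eigProj S (truncLevel S α) := by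
  ext x
  rw [ContinuousLinearMap.comp_apply, regInv, eigProj, sum_smul_tensor_apply, map_sum,
    _root_.sum_apply]
  refine Finset.sum_congr rfl fun j hj => ?_
  have hne : eigval S j ≠ 0 :=
    ((Real.sqrt_nonneg α).trans_lt (sqrt_lt_eigval hS hα (Finset.mem_range.mp hj))).ne'
  rw [map_smul, hS.apply_eq, smul_smul, tensor_apply]
  congr 1
  field_simp

/-- The remainder is governed by the first discarded eigenvalue, which is at most `√α`. -/
theorem norm_sub_comp_eigProj_le :
    ‖S - S ∘L eigProj S (truncLevel S α)‖ ≤ √α := by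
  have h1 : S ∘L eigProj S (truncLevel S α) = ∑ j ∈ Finset.range (truncLevel S α),
      eigval S j • tensor (eigvec S j) (eigvec S j) := by
    ext x
    rw [ContinuousLinearMap.comp_apply, sum_smul_tensor_apply, eigProj,
      _root_.sum_apply, map_sum]
    refine Finset.sum_congr rfl fun j _ => ?_
    rw [tensor_apply, map_smul, hS.apply_eq, smul_smul, mul_comm]
  rw [h1]
  refine (hS.norm_sub_le _).trans (Real.le_sqrt_of_sq_le ?_)
  by_contra hcon
  -- With indexing from zero, the first discarded eigenvalue has index `truncLevel S α` itself.
  exact lt_irrefl _ ((hS.lt_truncLevel_iff hα _).mpr (not_le.mp hcon))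

omit hα in
theorem norm_eigProj_le (K : ℕ) : ‖eigProj S K‖ ≤ 1 := by
  have := norm_sum_smul_tensor_le hS.orthonormal (Finset.range K) (fun _ => (1 : ℝ)) zero_le_one
    (fun j _ => by simp)
  simpa [eigProj] using this

end Spectral

/-! ### Self-adjointness, positivity and compactness of the truncated operators. -/

section SelfAdjointness

variable {H : Type*} [NormedAddCommGroup H] [InnerProductSpace ℝ H] [CompleteSpace H]
  {S : H →L[ℝ] H}

@[simp] theorem adjoint_eigProj (S : H →L[ℝ] H) (K : ℕ) :
    ContinuousLinearMap.adjoint (eigProj S K) = eigProj S K := by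
  simp [eigProj, adjoint_tensor]

@[simp] theorem adjoint_regInv (S : H →L[ℝ] H) (K : ℕ) :
    ContinuousLinearMap.adjoint (regInv S K) = regInv S K := by
  simp [regInv, adjoint_tensor]

omit [CompleteSpace H] in
theorem isPositive_regInv (hS : IsEigenSystem S (eigval S) (eigvec S)) (K : ℕ) :
    (regInv S K).IsPositive :=
  ContinuousLinearMap.isPositive_sum _ fun j _ =>
    (isPositive_tensor_self _).smul_of_nonneg (inv_nonneg.mpr (hS.nonneg j))

omit [CompleteSpace H] in
theorem isCompactOperator_regInv (S : H →L[ℝ] H) (K : ℕ) : IsCompactOperator (regInv S K) := by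
  have : regInv S K ∈ compactOperator (RingHom.id ℝ) H H :=
    Submodule.sum_mem _ fun j _ => Submodule.smul_mem _ _ (isCompactOperator_tensor _ _)
  exact this

end SelfAdjointness

/-! ### Hilbert-Schmidt operators and approximate right division. -/

section HilbertSchmidt

variable {H : Type*} [NormedAddCommGroup H] [InnerProductSpace ℝ H] [CompleteSpace H]

omit [CompleteSpace H] in
-- Cauchy-Schwarz for the expansion of `S x` in the basis, then Bessel, on finite partial sums
-- before passing to the limit.
theorem enorm_apply_sq_le_tsum {ι : Type*} (b : HilbertBasis ι ℝ H) (S : H →L[ℝ] H) (x : H) :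
    ‖S x‖ₑ ^ 2 ≤ ‖x‖ₑ ^ 2 * ∑' i, ‖S (b i)‖ₑ ^ 2 := by
  have h1 : HasSum (fun i => (b.repr x i) • S (b i)) (S x) := by
    simpa using (b.hasSum_repr x).mapL S
  have h2 : Tendsto (fun s : Finset ι => ‖∑ i ∈ s, (b.repr x i) • S (b i)‖ₑ ^ 2) atTop
      (𝓝 (‖S x‖ₑ ^ 2)) := ((ENNReal.continuous_pow 2).tendsto _).comp
        ((continuous_enorm.tendsto _).comp h1)
  refine le_of_tendsto' h2 fun s => ?_
  refine le_trans ?_ (mul_le_mul_right (ENNReal.sum_le_tsum s) _)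
  have h3 : ‖∑ i ∈ s, (b.repr x i) • S (b i)‖ ^ 2 ≤ ‖x‖ ^ 2 * ∑ i ∈ s, ‖S (b i)‖ ^ 2 := by
    calc ‖∑ i ∈ s, (b.repr x i) • S (b i)‖ ^ 2
        ≤ (∑ i ∈ s, ‖(b.repr x i : ℝ)‖ * ‖S (b i)‖) ^ 2 := by
          gcongr
          refine (norm_sum_le _ _).trans_eq ?_
          simp_rw [norm_smul]
      _ ≤ (∑ i ∈ s, ‖(b.repr x i : ℝ)‖ ^ 2) * ∑ i ∈ s, ‖S (b i)‖ ^ 2 :=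
          Finset.sum_mul_sq_le_sq_mul_sq _ _ _
      _ ≤ ‖x‖ ^ 2 * ∑ i ∈ s, ‖S (b i)‖ ^ 2 := by
          gcongr
          simp_rw [b.repr_apply_apply]
          exact b.orthonormal.sum_inner_products_le x
  have h4 := ENNReal.ofReal_le_ofReal h3
  rw [ENNReal.ofReal_mul (by positivity), ENNReal.ofReal_sum_of_nonneg (fun i _ => by positivity)]
    at h4
  simpa [ENNReal.ofReal_pow] using h4

omit [CompleteSpace H] in
theorem enorm_sq_le_tsum {ι : Type*} (b : HilbertBasis ι ℝ H) (S : H →L[ℝ] H) :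
    ‖S‖ₑ ^ 2 ≤ ∑' i, ‖S (b i)‖ₑ ^ 2 := by
  rcases eq_or_ne (∑' i, ‖S (b i)‖ₑ ^ 2) ∞ with h | h
  · rw [h]; exact le_top
  have h1 : ‖S‖ ≤ √(∑' i, ‖S (b i)‖ₑ ^ 2).toReal := by
    refine ContinuousLinearMap.opNorm_le_bound _ (Real.sqrt_nonneg _) fun x => ?_
    have h2 := ENNReal.toReal_mono (ENNReal.mul_ne_top (by simp) h) (enorm_apply_sq_le_tsum b S x)
    rw [ENNReal.toReal_mul, ENNReal.toReal_pow, ENNReal.toReal_pow, toReal_enorm, toReal_enorm]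
      at h2
    refine le_of_sq_le_sq ?_ (by positivity)
    rw [mul_pow, Real.sq_sqrt ENNReal.toReal_nonneg, mul_comm]
    exact h2
  have h2 : ‖S‖ ^ 2 ≤ (∑' i, ‖S (b i)‖ₑ ^ 2).toReal := by
    have := pow_le_pow_left₀ (norm_nonneg _) h1 2
    rwa [Real.sq_sqrt ENNReal.toReal_nonneg] at this
  have h3 := ENNReal.ofReal_le_ofReal h2
  rwa [ENNReal.ofReal_toReal h, ENNReal.ofReal_pow (norm_nonneg _), ofReal_norm] at h3

/-- The Hilbert basis in which `hsNorm` is computed. -/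
theorem exists_hilbertBasis_hsNorm_sq (H : Type*) [NormedAddCommGroup H] [InnerProductSpace ℝ H]
    [CompleteSpace H] : ∃ (w : Set H) (b : HilbertBasis w ℝ H),
      ∀ S : H →L[ℝ] H, hsNorm S ^ 2 = ∑' i, ‖S (b i)‖ₑ ^ 2 := by
  obtain ⟨b, hb⟩ := (exists_hilbertBasis ℝ H).choose_spec
  refine ⟨_, b, fun S => ?_⟩
  rw [hsNorm, hb, ← ENNReal.rpow_natCast, ← ENNReal.rpow_mul]
  norm_num

theorem enorm_le_hsNorm (S : H →L[ℝ] H) : ‖S‖ₑ ≤ hsNorm S := by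
  obtain ⟨w, b, hb⟩ := exists_hilbertBasis_hsNorm_sq H
  have h := enorm_sq_le_tsum b S
  rw [← hb] at h
  exact (ENNReal.pow_le_pow_left_iff two_ne_zero).mp h

/-- A Hilbert-Schmidt operator is a norm limit of finite sums of rank-one operators. -/
theorem mem_of_hsNorm_lt_top {S : H →L[ℝ] H} (hS : hsNorm S < ∞)
    (W : Submodule ℝ (H →L[ℝ] H)) (hW : IsClosed (W : Set (H →L[ℝ] H)))
    (htensor : ∀ a b, tensor a b ∈ W) : S ∈ W := by
  obtain ⟨w, b, hb⟩ := exists_hilbertBasis_hsNorm_sq H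
  have hsum : ∑' i, ‖S (b i)‖ₑ ^ 2 ≠ ∞ := by
    rw [← hb]; exact ENNReal.pow_ne_top hS.ne
  have hlim := ENNReal.tendsto_tsum_compl_atTop_zero hsum
  classical
  -- The error vanishes on the basis vectors in `F` and equals `-S (b i)` on the others, so the tail
  -- of the convergent series controls it.
  have hle : ∀ F : Finset w, ‖(∑ i ∈ F, tensor (b i) (S (b i))) - S‖ₑ ^ 2 ≤
      ∑' i : {i // i ∉ F}, ‖S (b i)‖ₑ ^ 2 := fun F => by
    refine (enorm_sq_le_tsum b _).trans ?_
    rw [show (∑' i : {i // i ∉ F}, ‖S (b i)‖ₑ ^ 2) = ∑' i : ((F : Set w)ᶜ : Set w), ‖S (b i)‖ₑ ^ 2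
      from rfl, tsum_subtype ((F : Set w)ᶜ) (fun i => ‖S (b i)‖ₑ ^ 2)]
    refine ENNReal.tsum_le_tsum fun i => ?_
    have happ : (∑ k ∈ F, tensor (b k) (S (b k))) (b i) = if i ∈ F then S (b i) else 0 := by
      rw [_root_.sum_apply]
      simp only [tensor_apply, orthonormal_iff_ite.mp b.orthonormal, ite_smul, one_smul, zero_smul,
        Finset.sum_ite_eq']
    rw [sub_apply, happ]
    by_cases hi : i ∈ F <;> simp [hi]
  have hlim2 : Tendsto (fun F : Finset w => ‖(∑ i ∈ F, tensor (b i) (S (b i))) - S‖ₑ) atTop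
      (𝓝 0) := by
    have h1 := tendsto_of_tendsto_of_tendsto_of_le_of_le tendsto_const_nhds hlim (fun _ => zero_le)
      hle
    have h2 := h1.ennrpow_const (1 / 2)
    rw [ENNReal.zero_rpow_of_pos (by norm_num)] at h2
    refine h2.congr fun F => ?_
    rw [← ENNReal.rpow_natCast, ← ENNReal.rpow_mul]
    norm_num
  refine hW.mem_of_tendsto (f := fun F : Finset w => ∑ i ∈ F, tensor (b i) (S (b i))) (b := atTop)
    ?_ (Eventually.of_forall fun F => W.sum_mem fun i _ => htensor _ _)
  rw [tendsto_iff_edist_tendsto_0]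
  simpa only [edist_eq_enorm_sub] using hlim2

/-- A closed subspace of operators that contains every `G ∘ Q`, for an injective self-adjoint `Q`,
contains every rank-one operator. -/
theorem tensor_mem_of_comp_mem {Q : H →L[ℝ] H} (hQ : IsSelfAdjoint Q) (hker : Q.ker = ⊥)
    (W : Submodule ℝ (H →L[ℝ] H)) (hW : IsClosed (W : Set (H →L[ℝ] H)))
    (hcomp : ∀ G : H →L[ℝ] H, G ∘L Q ∈ W) (a b : H) : tensor a b ∈ W := by
  have hadj : ContinuousLinearMap.adjoint Q = Q := hQ.adjoint_eq
  -- Injectivity and self-adjointness give dense range: its orthogonal complement is the kernel of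
  -- the adjoint.
  have hdense : Dense (Q.range : Set H) := by
    rw [Submodule.dense_iff_topologicalClosure_eq_top, Submodule.topologicalClosure_eq_top_iff,
      ContinuousLinearMap.orthogonal_range, hadj, hker]
  obtain ⟨q, hq, hqa⟩ := mem_closure_iff_seq_limit.mp (hdense a)
  have hlim : Tendsto (fun n => tensor (q n) b) atTop (𝓝 (tensor a b)) :=
    ((continuous_tensor_left b).tendsto a).comp hqa
  refine hW.mem_of_tendsto hlim (Eventually.of_forall fun n => ?_)
  obtain ⟨c, hc⟩ := hq n
  -- Composing `tensor c b` with `Q` moves `Q` onto the left factor, giving `tensor (Q c) b`.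
  have h1 := hcomp (tensor c b)
  rw [tensor_comp, hadj] at h1
  have hc' : q n = Q c := hc.symm
  change tensor (q n) b ∈ W
  rw [hc']
  exact h1

/-- A Hilbert-Schmidt operator is approximately divisible on the right by an injective
self-adjoint operator. -/
theorem exists_norm_sub_comp_le {A Q : H →L[ℝ] H} (hA : hsNorm A < ∞) (hQ : IsSelfAdjoint Q)
    (hker : Q.ker = ⊥) {δ : ℝ} (hδ : 0 < δ) : ∃ G : H →L[ℝ] H, ‖A - G ∘L Q‖ ≤ δ := by
  let L : (H →L[ℝ] H) →ₗ[ℝ] (H →L[ℝ] H) :=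
    { toFun := fun G => G ∘L Q
      map_add' := fun G G' => ContinuousLinearMap.add_comp G G' Q
      map_smul' := fun c G => ContinuousLinearMap.smul_comp c G Q }
  have hL : ∀ G, L G = G ∘L Q := fun G => rfl
  clear_value L
  have hcl : IsClosed (L.range.topologicalClosure : Set (H →L[ℝ] H)) :=
    Submodule.isClosed_topologicalClosure _
  have hmem : A ∈ L.range.topologicalClosure :=
    mem_of_hsNorm_lt_top hA _ hcl <| tensor_mem_of_comp_mem hQ hker _ hcl fun G =>
      Submodule.le_topologicalClosure _ ⟨G, hL G⟩
  obtain ⟨_, ⟨G, rfl⟩, hG⟩ := Metric.mem_closure_iff.mp hmem δ hδ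
  refine ⟨G, ?_⟩
  rw [dist_eq_norm, hL] at hG
  exact hG.le

end HilbertSchmidt

/-! ### Calculus of `O_p` and `o_p`. -/

section BoundsInProbability

variable {Ω : Type*} [MeasurableSpace Ω] {P : Measure Ω} {X Y : ℕ → Ω → ℝ≥0∞} {r : ℕ → ℝ}

theorem IsLittleOpOne.mono (hY : IsLittleOpOne P Y) (h : ∀ᶠ T in atTop, ∀ᵐ ω ∂P, X T ω ≤ Y T ω) :
    IsLittleOpOne P X := fun ε hε => by
  refine tendsto_of_tendsto_of_tendsto_of_le_of_le' tendsto_const_nhds (hY ε hε)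
    (Eventually.of_forall fun _ => zero_le) ?_
  filter_upwards [h] with T hT
  refine measure_mono_ae ?_
  filter_upwards [hT] with ω hω hε
  exact le_trans hε hω

theorem IsBigOp.mono (hY : IsBigOp P Y r) (h : ∀ᶠ T in atTop, ∀ᵐ ω ∂P, X T ω ≤ Y T ω) :
    IsBigOp P X r := fun ε hε => by
  obtain ⟨M, hM, hYM⟩ := hY ε hε
  refine ⟨M, hM, ?_⟩
  filter_upwards [h, hYM] with T hT hTM
  refine (measure_mono_ae ?_).trans hTM
  filter_upwards [hT] with ω hω hε
  exact lt_of_lt_of_le hε hω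

theorem IsLittleOpOne.add (hX : IsLittleOpOne P X) (hY : IsLittleOpOne P Y) :
    IsLittleOpOne P fun T ω => X T ω + Y T ω := fun ε hε => by
  have hε2 : 0 < ε / 2 := ENNReal.half_pos hε.ne'
  have hlim := (hX _ hε2).add (hY _ hε2)
  rw [add_zero] at hlim
  refine tendsto_of_tendsto_of_tendsto_of_le_of_le tendsto_const_nhds hlim (fun _ => zero_le)
    fun T => (measure_mono fun ω hω => ?_).trans (measure_union_le _ _)
  by_contra hcon
  rw [Set.mem_union, not_or] at hcon
  have h1 := ENNReal.add_lt_add (not_le.mp hcon.1) (not_le.mp hcon.2)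
  rw [ENNReal.add_halves] at h1
  exact absurd hω (not_le.mpr h1)

theorem IsLittleOpOne.const_mul (hX : IsLittleOpOne P X) {c : ℝ≥0∞} (hc : c ≠ ∞) :
    IsLittleOpOne P fun T ω => c * X T ω := fun ε hε => by
  refine tendsto_of_tendsto_of_tendsto_of_le_of_le tendsto_const_nhds
    (hX (ε / c) (ENNReal.div_pos hε.ne' hc)) (fun _ => zero_le) fun T => measure_mono fun ω hω => ?_
  exact ENNReal.div_le_of_le_mul' hω

theorem IsLittleOpOne.sq (hX : IsLittleOpOne P X) : IsLittleOpOne P fun T ω => X T ω ^ 2 :=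
  fun ε hε => by
  refine tendsto_of_tendsto_of_tendsto_of_le_of_le tendsto_const_nhds
    -- Below the cap `1`, squaring only decreases, so `X < min ε 1` already forces `X ^ 2 < ε`.
    (hX (min ε 1) (lt_min hε one_pos)) (fun _ => zero_le) fun T => measure_mono fun ω hω => ?_
  by_contra hcon
  have h1 : X T ω < min ε 1 := not_le.mp hcon
  have h2 : X T ω ^ 2 < ε := by
    rw [pow_two]
    exact (mul_le_of_le_one_right' (h1.trans_le (min_le_right _ _)).le).trans_lt
      (h1.trans_le (min_le_left _ _))
  exact absurd hω (not_le.mpr h2)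

theorem IsLittleOpOne.of_sq (hX : IsLittleOpOne P fun T ω => X T ω ^ 2) : IsLittleOpOne P X :=
  fun ε hε => by
  refine tendsto_of_tendsto_of_tendsto_of_le_of_le tendsto_const_nhds
    (hX (ε ^ 2) (ENNReal.pow_pos hε 2)) (fun _ => zero_le) fun T => measure_mono fun ω hω => ?_
  have h1 : ε ≤ X T ω := hω
  exact pow_le_pow_left' h1 2

theorem isLittleOpOne_ofReal (P : Measure Ω) (hr : Tendsto r atTop (𝓝 0)) :
    IsLittleOpOne P fun T _ => ENNReal.ofReal (r T) := fun ε hε => by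
  refine tendsto_const_nhds.congr' ?_
  have h1 := ENNReal.tendsto_ofReal hr
  rw [ENNReal.ofReal_zero] at h1
  filter_upwards [h1.eventually (gt_mem_nhds hε)] with T hT
  rw [eq_comm]
  convert measure_empty (μ := P)
  ext ω
  simpa using hT

theorem IsBigOp.isLittleOpOne (hX : IsBigOp P X r) (hr : Tendsto r atTop (𝓝 0)) :
    IsLittleOpOne P X := fun ε hε => by
  rw [ENNReal.tendsto_nhds_zero]
  intro η hη
  obtain ⟨M, -, hXM⟩ := hX η hη
  have h1 := ENNReal.tendsto_ofReal (hr.const_mul M)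
  rw [mul_zero, ENNReal.ofReal_zero] at h1
  filter_upwards [hXM, h1.eventually (gt_mem_nhds hε)] with T hT hT2
  exact (measure_mono fun ω hω => lt_of_lt_of_le hT2 hω).trans hT

/-- Turns the `T^{-1/2}` rate of a sample operator into a rate for its squared norm times a power of
a regularization parameter; the constant `M` becomes `M ^ 2`. -/
theorem IsBigOp.sq_mul (hX : IsBigOp P X r) (hr : ∀ T, 0 ≤ r T) (s : ℕ → ℝ) :
    IsBigOp P (fun T ω => X T ω ^ 2 * ENNReal.ofReal (s T)) (fun T => r T ^ 2 * s T) :=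
  fun ε hε => by
  obtain ⟨M, hM, hXM⟩ := hX ε hε
  refine ⟨M ^ 2, by positivity, ?_⟩
  filter_upwards [hXM] with T hT
  refine (measure_mono fun ω hω => ?_).trans hT
  by_contra hcon
  have hω' : ENNReal.ofReal (M ^ 2 * (r T ^ 2 * s T)) < X T ω ^ 2 * ENNReal.ofReal (s T) := hω
  refine absurd hω' (not_lt.mpr ?_)
  have h1 : X T ω ≤ ENNReal.ofReal (M * r T) := not_lt.mp hcon
  have h2 : M ^ 2 * (r T ^ 2 * s T) = (M * r T) ^ 2 * s T := by ring
  have h3 : 0 ≤ M * r T := mul_nonneg hM.le (hr T)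
  rw [h2, ENNReal.ofReal_mul (by positivity), ENNReal.ofReal_pow h3]
  gcongr

/-- A quantity is `o_p(1)` if it is `o_p(1)` up to every positive constant. -/
theorem isLittleOpOne_of_forall_le_add
    (h : ∀ δ : ℝ, 0 < δ → ∃ Y, IsLittleOpOne P Y ∧ ∀ T ω, X T ω ≤ ENNReal.ofReal δ + Y T ω) :
    IsLittleOpOne P X := fun ε hε => by
  -- The threshold `ε` may be `∞`; capping it at `1` leaves a finite half that can serve as `δ`.
  have hm0 : 0 < min ε 1 := lt_min hε one_pos
  have hmt : min ε 1 ≠ ∞ := ((min_le_right _ _).trans_lt ENNReal.one_lt_top).ne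
  have hh : min ε 1 / 2 ≠ ∞ := ENNReal.div_ne_top hmt two_ne_zero
  have hh0 : 0 < min ε 1 / 2 := ENNReal.half_pos hm0.ne'
  obtain ⟨Y, hY, hXY⟩ := h _ (ENNReal.toReal_pos hh0.ne' hh)
  refine tendsto_of_tendsto_of_tendsto_of_le_of_le tendsto_const_nhds
    (hY _ hh0) (fun _ => zero_le) fun T => measure_mono fun ω hω => ?_
  by_contra hcon
  have h1 := ENNReal.add_lt_add_left hh (not_le.mp hcon)
  rw [ENNReal.add_halves] at h1
  have h2 := hXY T ω
  rw [ENNReal.ofReal_toReal hh] at h2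
  exact absurd (hω.trans h2) (not_le.mpr (h1.trans_le (min_le_left _ _)))

end BoundsInProbability

/-! ### Second-moment operators. -/

section Moments

variable {Ω : Type*} [MeasurableSpace Ω] {P : Measure Ω} {H : Type*} [NormedAddCommGroup H]
  [InnerProductSpace ℝ H] {X Y Z : Ω → H}

theorem integrable_tensor (hX : MemLp X 2 P) (hY : MemLp Y 2 P) :
    Integrable (fun ω => tensor (X ω) (Y ω)) P := by
  have hm := (tensorL (H := H)).aestronglyMeasurable_comp₂ hX.aestronglyMeasurable
    hY.aestronglyMeasurable
  simp only [tensorL_apply] at hm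
  refine (hX.norm.integrable_mul hY.norm).mono hm (Eventually.of_forall fun ω => ?_)
  simp [norm_tensor]

theorem integrable_inner_mul_inner (hX : MemLp X 2 P) (hY : MemLp Y 2 P) (ζ η : H) :
    Integrable (fun ω => (inner ℝ (X ω) ζ : ℝ) * inner ℝ (Y ω) η) P := by
  have h := ((integrable_tensor hX hY).apply_continuousLinearMap ζ).const_inner (𝕜 := ℝ) η
  refine h.congr (Eventually.of_forall fun ω => ?_)
  simp [inner_smul_right, real_inner_comm]

variable [CompleteSpace H]

theorem inner_momentOp (hX : MemLp X 2 P) (hY : MemLp Y 2 P) (ζ η : H) :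
    inner ℝ η (momentOp P X Y ζ) = ∫ ω, (inner ℝ (X ω) ζ : ℝ) * inner ℝ (Y ω) η ∂P := by
  have hi := integrable_tensor hX hY
  rw [momentOp, ContinuousLinearMap.integral_apply hi,
    ← integral_inner (hi.apply_continuousLinearMap ζ)]
  refine integral_congr_ae (Eventually.of_forall fun ω => ?_)
  simp [inner_smul_right, real_inner_comm]

theorem inner_momentOp_swap (hX : MemLp X 2 P) (hY : MemLp Y 2 P) (ζ η : H) :
    inner ℝ η (momentOp P X Y ζ) = inner ℝ ζ (momentOp P Y X η) := by
  rw [inner_momentOp hX hY, inner_momentOp hY hX]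
  simp_rw [mul_comm]

theorem isPositive_momentOp_self (hX : MemLp X 2 P) : (momentOp P X X).IsPositive := by
  refine ⟨fun ζ η => ?_, fun ζ => ?_⟩
  · have := inner_momentOp_swap hX hX ζ η
    rw [real_inner_comm] at this
    exact this
  · have h1 := inner_momentOp hX hX ζ ζ
    rw [real_inner_comm] at h1
    change 0 ≤ inner ℝ (momentOp P X X ζ) ζ
    rw [h1]
    exact integral_nonneg fun ω => mul_self_nonneg _

/-- Compact operators form a closed convex set, so an average of rank-one operators stays in it. -/
theorem isCompactOperator_momentOp [IsProbabilityMeasure P] (hX : MemLp X 2 P)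
    (hY : MemLp Y 2 P) : IsCompactOperator (momentOp P X Y) := by
  have h := (compactOperator (RingHom.id ℝ) H H).convex.integral_mem
    (isClosed_setOfPred_isCompactOperator) (μ := P)
    (Eventually.of_forall fun ω => isCompactOperator_tensor (X ω) (Y ω)) (integrable_tensor hX hY)
  exact h

/-- The population normal equation of the first stage, checked on matrix coefficients, where the
error contributes nothing. -/
theorem momentOp_eq_comp_adjoint {B : H →L[ℝ] H} (hX : MemLp X 2 P) (hZ : MemLp Z 2 P)
    (hV : MemLp Y 2 P) (hXZ : ∀ᵐ ω ∂P, X ω = B (Z ω) + Y ω) (h0 : momentOp P Z Y = 0) :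
    momentOp P X Z = momentOp P Z Z ∘L ContinuousLinearMap.adjoint B := by
  refine ContinuousLinearMap.ext fun ζ => ext_inner_left ℝ fun η => ?_
  have h1 : ∫ ω, (inner ℝ (Y ω) ζ : ℝ) * inner ℝ (Z ω) η ∂P = 0 := by
    rw [← inner_momentOp hV hZ, inner_momentOp_swap hV hZ, h0]; simp
  rw [ContinuousLinearMap.comp_apply, inner_momentOp hX hZ, inner_momentOp hZ hZ]
  rw [← add_zero (∫ ω, (inner ℝ (Z ω) _ : ℝ) * _ ∂P), ← h1,
    ← integral_add (integrable_inner_mul_inner hZ hZ _ _) (integrable_inner_mul_inner hV hZ _ _)]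
  refine integral_congr_ae ?_
  filter_upwards [hXZ] with ω hω
  rw [hω, inner_add_left, ContinuousLinearMap.adjoint_inner_right, add_mul]

end Moments

/-- A centered error given a σ-algebra is uncorrelated with every variable measurable in it. -/
theorem momentOp_eq_zero_of_condExp {Ω : Type*} {m mΩ : MeasurableSpace Ω} {P : Measure Ω}
    [IsFiniteMeasure P] {H : Type*} [NormedAddCommGroup H] [InnerProductSpace ℝ H]
    [CompleteSpace H] {X Y : Ω → H} (hm : m ≤ mΩ) (hX : MemLp X 2 P) (hY : MemLp Y 2 P)
    (hYm : StronglyMeasurable[m] Y) (h0 : P[X | m] =ᵐ[P] 0) : momentOp P X Y = 0 := by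
  have hi : Integrable (fun ω => tensorL (X ω) (Y ω)) P := by
    simpa only [tensorL_apply] using integrable_tensor hX hY
  have h1 : P[fun ω => tensor (X ω) (Y ω) | m] =ᵐ[P] fun ω => tensor (P[X | m] ω) (Y ω) := by
    simpa only [tensorL_apply] using
      condExp_bilin_of_stronglyMeasurable_right tensorL hYm hi (hX.integrable one_le_two)
  rw [momentOp, ← integral_condExp hm]
  refine integral_eq_zero_of_ae (h1.trans ?_)
  filter_upwards [h0] with ω hω
  rw [hω]
  exact tensor_zero_left _

/-! ### Identification of the population operator. -/

section PopulationOperator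

variable {H : Type*} [NormedAddCommGroup H] [InnerProductSpace ℝ H] [CompleteSpace H]

/-- With `C = D B*` one has `C* e_j = μ_j B e_j`. One factor `μ_j` cancels against the inverse, so
the series is that of `D` conjugated by `B`. -/
theorem sandwichInv_comp_adjoint {D B : H →L[ℝ] H} (hD : IsEigenSystem D (eigval D) (eigvec D))
    (hsa : ContinuousLinearMap.adjoint D = D) (hinf : ¬ FiniteDimensional ℝ H)
    (hker : (sandwichInv D (D ∘L ContinuousLinearMap.adjoint B)).ker = ⊥) :
    sandwichInv D (D ∘L ContinuousLinearMap.adjoint B) =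
      B ∘L D ∘L ContinuousLinearMap.adjoint B := by
  set C := D ∘L ContinuousLinearMap.adjoint B with hC
  have hterm : ∀ j, (eigval D j)⁻¹ • tensor (ContinuousLinearMap.adjoint C (eigvec D j))
      (ContinuousLinearMap.adjoint C (eigvec D j)) = B ∘L (eigval D j •
        tensor (eigvec D j) (eigvec D j)) ∘L ContinuousLinearMap.adjoint B := fun j => by
    have h1 : ContinuousLinearMap.adjoint C (eigvec D j) = eigval D j • B (eigvec D j) := by
      rw [hC, ContinuousLinearMap.adjoint_comp, hsa, ContinuousLinearMap.adjoint_adjoint,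
        ContinuousLinearMap.comp_apply, hD.apply_eq, map_smul]
    rw [h1]
    ext ζ
    simp only [smul_apply, ContinuousLinearMap.comp_apply, tensor_apply,
      inner_smul_left, map_smul, smul_smul, ContinuousLinearMap.adjoint_inner_right]
    congr 1
    rcases eq_or_ne (eigval D j) 0 with h0 | h0
    · simp [h0]
    · simp; field_simp
  -- A divergent `tsum` would default to `0`, whose kernel is all of `H`; trivial kernel and
  -- infinite dimension exclude this.
  have hsum : Summable fun j => (eigval D j)⁻¹ •
      tensor (ContinuousLinearMap.adjoint C (eigvec D j))
        (ContinuousLinearMap.adjoint C (eigvec D j)) := by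
    by_contra hns
    have h0 : sandwichInv D C = 0 := tsum_eq_zero_of_not_summable hns
    have hsub : Subsingleton H := by
      refine subsingleton_of_forall_eq 0 fun w => ?_
      have hw : w ∈ (sandwichInv D C).ker := by rw [h0]; simp
      rw [hker] at hw
      exact (Submodule.mem_bot ℝ).mp hw
    exact hinf inferInstance
  refine tendsto_nhds_unique hsum.hasSum.tendsto_sum_nat ?_
  have h2 : Tendsto (fun n => B ∘L (∑ j ∈ Finset.range n, eigval D j •
      tensor (eigvec D j) (eigvec D j)) ∘L ContinuousLinearMap.adjoint B) atTop
      (𝓝 (B ∘L D ∘L ContinuousLinearMap.adjoint B)) :=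
    ((continuous_const.clm_comp (continuous_id.clm_comp continuous_const)).tendsto D).comp hD.tendsto
  refine h2.congr fun n => ?_
  rw [Finset.sum_congr rfl fun j _ => hterm j, ContinuousLinearMap.finsetSum_comp,
    ContinuousLinearMap.comp_finsetSum]

end PopulationOperator

/-! ### Deterministic bounds for noise, sampling error and truncation bias. -/

section OperatorBounds

variable {H : Type*} [NormedAddCommGroup H] [InnerProductSpace ℝ H] [CompleteSpace H]

/-- `C* D_K⁻¹ C` has ordered eigenelements. -/
theorem isEigenSystem_sandwich_regInv (hinf : ¬ FiniteDimensional ℝ H) {D : H →L[ℝ] H}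
    (hD : IsEigenSystem D (eigval D) (eigvec D)) (C : H →L[ℝ] H) (K : ℕ) :
    let Q := ContinuousLinearMap.adjoint C ∘L regInv D K ∘L C
    IsEigenSystem Q (eigval Q) (eigvec Q) :=
  isEigenSystem_eigval_eigvec hinf _
    (((isCompactOperator_regInv D K).comp_clm C).clm_comp (ContinuousLinearMap.adjoint C))
    ((isPositive_regInv hD K).adjoint_conj C)

/-- Bound on the stochastic part of the two-stage estimator. -/
theorem norm_sq_noise_le {D C Q : H →L[ℝ] H} (U : H →L[ℝ] H) {α β : ℝ} (hα : 0 < α) (hβ : 0 < β)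
    (hD : IsEigenSystem D (eigval D) (eigvec D)) (hQ : IsEigenSystem Q (eigval Q) (eigvec Q))
    (hQC : Q = ContinuousLinearMap.adjoint C ∘L regInv D (truncLevel D α) ∘L C) :
    ‖ContinuousLinearMap.adjoint U ∘L regInv D (truncLevel D α) ∘L C ∘L
      regInv Q (truncLevel Q β)‖ ^ 2 ≤ ‖U‖ ^ 2 * ((√α)⁻¹ * (√β)⁻¹) := by
  set R := regInv D (truncLevel D α) with hR
  set G := regInv Q (truncLevel Q β) with hG
  have hα' : 0 ≤ (√α)⁻¹ := by positivity
  have hβ' : 0 ≤ (√β)⁻¹ := by positivity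
  have h1 : ‖R ∘L C ∘L G‖ ≤ √((√α)⁻¹ * (√β)⁻¹) := by
    refine ContinuousLinearMap.opNorm_le_bound _ (Real.sqrt_nonneg _) fun ζ => ?_
    refine le_of_sq_le_sq ?_ (by positivity)
    rw [mul_pow, Real.sq_sqrt (by positivity)]
    have h2 : ‖R (C (G ζ))‖ ^ 2 ≤ (√α)⁻¹ * inner ℝ (C (G ζ)) (R (C (G ζ))) :=
      norm_sq_regInv_apply_le hD hα _
    -- The quadratic form of `R` at `C (G ζ)` is that of `Q` at `G ζ`, and `Q ∘ G` is a projection,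
    -- so a single factor `‖G‖` remains.
    have h3 : inner ℝ (C (G ζ)) (R (C (G ζ))) = inner ℝ (G ζ) (Q (G ζ)) := by
      rw [hQC, ContinuousLinearMap.comp_apply, ContinuousLinearMap.comp_apply,
        ContinuousLinearMap.adjoint_inner_right]
    have h4 : Q (G ζ) = eigProj Q (truncLevel Q β) ζ := by
      rw [← comp_regInv hQ hβ]; rfl
    have h5 : inner ℝ (G ζ) (Q (G ζ)) ≤ (√β)⁻¹ * ‖ζ‖ ^ 2 := by
      calc inner ℝ (G ζ) (Q (G ζ)) ≤ ‖G ζ‖ * ‖Q (G ζ)‖ := real_inner_le_norm _ _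
        _ ≤ ((√β)⁻¹ * ‖ζ‖) * (1 * ‖ζ‖) := by
            rw [h4]
            gcongr
            · exact G.le_of_opNorm_le (norm_regInv_le hQ hβ) ζ
            · exact (eigProj Q _).le_of_opNorm_le (norm_eigProj_le hQ _) ζ
        _ = (√β)⁻¹ * ‖ζ‖ ^ 2 := by ring
    calc ‖R (C (G ζ))‖ ^ 2 ≤ (√α)⁻¹ * inner ℝ (C (G ζ)) (R (C (G ζ))) := h2
      _ ≤ (√α)⁻¹ * ((√β)⁻¹ * ‖ζ‖ ^ 2) := by rw [h3]; gcongr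
      _ = _ := by ring
  calc _ ≤ (‖U‖ * √((√α)⁻¹ * (√β)⁻¹)) ^ 2 := by
        refine pow_le_pow_left₀ (norm_nonneg _) ?_ 2
        refine (ContinuousLinearMap.opNorm_comp_le _ _).trans ?_
        rw [LinearIsometryEquiv.norm_map]
        gcongr
    _ = _ := by rw [mul_pow, Real.sq_sqrt (by positivity)]

/-- The identities `s r = r s = p` remove `r` from every term except the one quadratic in the
errors; that term alone pays for the size of the inverse. -/
theorem sandwich_expansion {R : Type*} [Ring R] {b b' v v' s d r p : R} (h1 : s * r = p)
    (h2 : r * s = p) : (b * s + v') * (r * (s * b' + v)) - b * (d * b') =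
      b * ((s - d) * b') - b * ((s - s * p) * b') + b * (p * v) + v' * (p * b') + v' * (r * v) := by
  have h : (b * s + v') * (r * (s * b' + v)) = b * (s * (r * s) * b') + b * ((s * r) * v) +
      v' * ((r * s) * b') + v' * (r * v) := by noncomm_ring
  rw [h, h1, h2]
  noncomm_ring

/-- Distance of the sample version of `C* D⁻¹ C`, with `C = D B*` up to an error `V`, from
`B D B*`. -/
theorem norm_sandwich_sub_le {S : H →L[ℝ] H} (D B V : H →L[ℝ] H) {α : ℝ} (hα : 0 < α)
    (hS : IsEigenSystem S (eigval S) (eigvec S)) (hsa : ContinuousLinearMap.adjoint S = S) :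
    ‖ContinuousLinearMap.adjoint (S ∘L ContinuousLinearMap.adjoint B + V) ∘L
        regInv S (truncLevel S α) ∘L (S ∘L ContinuousLinearMap.adjoint B + V) -
      B ∘L D ∘L ContinuousLinearMap.adjoint B‖ ≤
    ‖B‖ ^ 2 * (‖S - D‖ + √α) + 2 * ‖B‖ * ‖V‖ + ‖V‖ ^ 2 * (√α)⁻¹ := by
  set B' := ContinuousLinearMap.adjoint B with hB'
  set V' := ContinuousLinearMap.adjoint V with hV'
  set R := regInv S (truncLevel S α) with hR
  set p := eigProj S (truncLevel S α) with hp
  have h1 : S * R = p := comp_regInv hS hα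
  have h2 : R * S = p := by
    have := congrArg ContinuousLinearMap.adjoint h1
    rwa [ContinuousLinearMap.mul_def, ContinuousLinearMap.adjoint_comp, hsa, hR, adjoint_regInv, hp,
      adjoint_eigProj] at this
  have h3 : ContinuousLinearMap.adjoint (S ∘L B' + V) = B * S + V' := by
    rw [map_add, ContinuousLinearMap.adjoint_comp, hsa, hB', ContinuousLinearMap.adjoint_adjoint]
    rfl
  have hexp := sandwich_expansion (b := B) (b' := B') (v := V) (v' := V') (d := D) h1 h2
  have hnB : ‖B'‖ = ‖B‖ := LinearIsometryEquiv.norm_map _ _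
  have hnV : ‖V'‖ = ‖V‖ := LinearIsometryEquiv.norm_map _ _
  have hnp : ‖p‖ ≤ 1 := norm_eigProj_le hS _
  have hnR : ‖R‖ ≤ (√α)⁻¹ := norm_regInv_le hS hα
  have hnS : ‖S - S * p‖ ≤ √α := norm_sub_comp_eigProj_le hS hα
  have hmul : ∀ a b c : H →L[ℝ] H, ‖a * (b * c)‖ ≤ ‖a‖ * (‖b‖ * ‖c‖) := fun a b c =>
    (norm_mul_le _ _).trans (mul_le_mul_of_nonneg_left (norm_mul_le _ _) (norm_nonneg _))
  have e1 := hmul B (S - D) B'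
  have e2 := (hmul B (S - S * p) B').trans (mul_le_mul_of_nonneg_left
    (mul_le_mul_of_nonneg_right hnS (norm_nonneg _)) (norm_nonneg _))
  have e3 := (hmul B p V).trans (mul_le_mul_of_nonneg_left
    (mul_le_mul_of_nonneg_right hnp (norm_nonneg _)) (norm_nonneg _))
  have e4 := (hmul V' p B').trans (mul_le_mul_of_nonneg_left
    (mul_le_mul_of_nonneg_right hnp (norm_nonneg _)) (norm_nonneg _))
  have e5 := (hmul V' R V).trans (mul_le_mul_of_nonneg_left
    (mul_le_mul_of_nonneg_right hnR (norm_nonneg _)) (norm_nonneg _))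
  rw [hnB] at e1 e2 e4
  rw [hnV] at e4 e5
  have key : ‖(B * S + V') * (R * (S * B' + V)) - B * (D * B')‖ ≤
      ‖B‖ ^ 2 * (‖S - D‖ + √α) + 2 * ‖B‖ * ‖V‖ + ‖V‖ ^ 2 * (√α)⁻¹ := by
    rw [hexp]
    refine (norm_add_le _ _).trans ?_
    have f1 := norm_add_le (B * ((S - D) * B') - B * ((S - S * p) * B') + B * (p * V))
      (V' * (p * B'))
    have f2 := norm_add_le (B * ((S - D) * B') - B * ((S - S * p) * B')) (B * (p * V))
    have f3 := norm_sub_le (B * ((S - D) * B')) (B * ((S - S * p) * B'))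
    linarith
  rw [h3]
  exact key

omit [CompleteSpace H] in
/-- An operator that nearly factors through `Q` is nearly annihilated by the discarded
eigendirections of an operator close to `Q`. -/
theorem norm_comp_id_sub_eigProj_le {S : H →L[ℝ] H} (A G Q : H →L[ℝ] H) {β : ℝ} (hβ : 0 < β)
    (hS : IsEigenSystem S (eigval S) (eigvec S)) :
    ‖A ∘L (ContinuousLinearMap.id ℝ H - eigProj S (truncLevel S β))‖ ≤
      2 * ‖A - G ∘L Q‖ + ‖G‖ * (2 * ‖S - Q‖ + √β) := by
  set p := eigProj S (truncLevel S β) with hp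
  have hnp : ‖p‖ ≤ 1 := norm_eigProj_le hS _
  have hn1 : ‖(1 : H →L[ℝ] H) - p‖ ≤ 2 := by
    refine (norm_sub_le _ _).trans ?_
    have : ‖(1 : H →L[ℝ] H)‖ ≤ 1 := ContinuousLinearMap.norm_id_le
    linarith
  have hnS : ‖S - S * p‖ ≤ √β := norm_sub_comp_eigProj_le hS hβ
  change ‖A * (1 - p)‖ ≤ 2 * ‖A - G * Q‖ + ‖G‖ * (2 * ‖S - Q‖ + √β)
  -- Replace `A` by `G Q`, then `Q` by `S`; what is left, `S (1 - p)`, contains only eigenvalues at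
  -- most `√β`.
  have hexp : A * (1 - p) = (A - G * Q) * (1 - p) + G * ((S - S * p) - (S - Q) * (1 - p)) := by
    noncomm_ring
  rw [hexp]
  have e1 : ‖(A - G * Q) * (1 - p)‖ ≤ ‖A - G * Q‖ * 2 :=
    (norm_mul_le _ _).trans (mul_le_mul_of_nonneg_left hn1 (norm_nonneg _))
  have e2 : ‖(S - Q) * (1 - p)‖ ≤ ‖S - Q‖ * 2 :=
    (norm_mul_le _ _).trans (mul_le_mul_of_nonneg_left hn1 (norm_nonneg _))
  have e3 : ‖(S - S * p) - (S - Q) * (1 - p)‖ ≤ 2 * ‖S - Q‖ + √β := by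
    refine (norm_sub_le _ _).trans ?_
    linarith
  have e4 := (norm_mul_le G ((S - S * p) - (S - Q) * (1 - p))).trans
    (mul_le_mul_of_nonneg_left e3 (norm_nonneg _))
  refine (norm_add_le _ _).trans ?_
  linarith

end OperatorBounds

/-! ### Sample covariance operators. -/

section SampleOperators

variable {Ω : Type*} {H : Type*} [NormedAddCommGroup H] [InnerProductSpace ℝ H]

theorem isEigenSystem_sampleOp [CompleteSpace H] (hinf : ¬ FiniteDimensional ℝ H)
    (z : ℕ → Ω → H) (T : ℕ) (ω : Ω) :
    IsEigenSystem (sampleOp z z T ω) (eigval (sampleOp z z T ω)) (eigvec (sampleOp z z T ω)) := by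
  refine isEigenSystem_eigval_eigvec hinf _ ?_ ?_
  · have : sampleOp z z T ω ∈ compactOperator (RingHom.id ℝ) H H :=
      Submodule.smul_mem _ _ (Submodule.sum_mem _ fun t _ => isCompactOperator_tensor _ _)
    exact this
  · exact (ContinuousLinearMap.isPositive_sum _ fun t _ =>
      isPositive_tensor_self _).smul_of_nonneg (by positivity)

theorem adjoint_sampleOp [CompleteSpace H] (x z : ℕ → Ω → H) (T : ℕ) (ω : Ω) :
    ContinuousLinearMap.adjoint (sampleOp x z T ω) = sampleOp z x T ω := by
  simp [sampleOp, adjoint_tensor]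

/-- Serves both equations: the outcome equation in the noise identity, and the first-stage equation
in the consistency of `Q̂`. -/
theorem sampleOp_eq_comp_adjoint_add [CompleteSpace H] {A : H →L[ℝ] H} {y x u : ℕ → Ω → H}
    (z : ℕ → Ω → H) {ω : Ω} (h : ∀ t, 1 ≤ t → y t ω = A (x t ω) + u t ω) (T : ℕ) :
    sampleOp y z T ω =
      sampleOp x z T ω ∘L ContinuousLinearMap.adjoint A + sampleOp u z T ω := by
  rw [sampleOp, sampleOp, sampleOp, ContinuousLinearMap.smul_comp,
    ContinuousLinearMap.finsetSum_comp, ← smul_add, ← Finset.sum_add_distrib]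
  congr 1
  refine Finset.sum_congr rfl fun t ht => ?_
  rw [h t (Finset.mem_Icc.mp ht).1, tensor_add_map_left]

end SampleOperators

/-! ### Consequences of the model assumptions. -/

section Model

variable {Ω : Type*} [MeasurableSpace Ω] {H : Type*} [NormedAddCommGroup H]
  [InnerProductSpace ℝ H] [CompleteSpace H] [MeasurableSpace H] {P : Measure Ω} {A B : H →L[ℝ] H}
  {y x z u v : ℕ → Ω → H}

theorem Assumptions.memLp_v (h : Assumptions P A B y x z u v) : MemLp (v 1) 2 P := by
  have h1 := (h.sq_integrable_x 1 le_rfl).sub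
    (B.comp_memLp' (h.sq_integrable_z 1 le_rfl))
  refine h1.ae_eq ?_
  filter_upwards [h.first_stage 1 le_rfl] with ω hω
  simp [hω]

/-- The instrument is exogenous. -/
theorem Assumptions.momentOp_uz [SecondCountableTopology H] [BorelSpace H]
    [IsProbabilityMeasure P] (h : Assumptions P A B y x z u v) :
    momentOp P (u 1) (z 1) = 0 := by
  -- The information set for `u 1` already contains the contemporaneous instrument `z 1`.
  have hsup : sigmaOf z (Set.Icc 1 1) ≤ pastSigma z u 1 := le_sup_left
  have hz : MeasurableSpace.comap (z 1) inferInstance ≤ sigmaOf z (Set.Icc 1 1) :=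
    le_iSup₂_of_le 1 (by simp) le_rfl
  refine momentOp_eq_zero_of_condExp (m := pastSigma z u 1) ?_ (h.sq_integrable_u 1 le_rfl)
    (h.sq_integrable_z 1 le_rfl) ?_ (h.mart_diff 1 le_rfl)
  · refine sup_le (iSup₂_le fun s hs => ?_) (iSup₂_le fun s hs => ?_)
    · exact (h.measurable_z s hs.1).comap_le
    · exact (h.measurable_u s hs.1).comap_le
  · have : Measurable[pastSigma z u 1] (z 1) := Measurable.of_comap_le (hz.trans hsup)
    exact this.stronglyMeasurable

/-- `C_xz* C_zz⁻¹ C_xz = B C_zz B*`. -/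
theorem Assumptions.popQ_eq [IsProbabilityMeasure P] (h : Assumptions P A B y x z u v)
    (hinf : ¬ FiniteDimensional ℝ H) :
    popQ P x z = B ∘L popCzz P z ∘L ContinuousLinearMap.adjoint B := by
  have hz := h.sq_integrable_z 1 le_rfl
  have hpos : (popCzz P z).IsPositive := isPositive_momentOp_self hz
  have hC : momentOp P (x 1) (z 1) = popCzz P z ∘L ContinuousLinearMap.adjoint B :=
    momentOp_eq_comp_adjoint (h.sq_integrable_x 1 le_rfl) hz h.memLp_v (h.first_stage 1 le_rfl)
      (h.first_stage_orth 1 le_rfl)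
  have hker := h.ker_Q
  rw [popQ, hC] at hker ⊢
  exact sandwichInv_comp_adjoint
    (isEigenSystem_eigval_eigvec hinf _ (isCompactOperator_momentOp hz hz) hpos)
    hpos.isSelfAdjoint.adjoint_eq hinf hker

theorem Assumptions.ae_model (h : Assumptions P A B y x z u v) :
    ∀ᵐ ω ∂P, ∀ t, 1 ≤ t → y t ω = A (x t ω) + u t ω :=
  ae_all_iff.mpr fun t => by
    by_cases ht : 1 ≤ t
    · filter_upwards [h.model t ht] with ω hω _ using hω
    · exact Eventually.of_forall fun ω ht' => absurd ht' ht

theorem Assumptions.ae_first_stage (h : Assumptions P A B y x z u v) :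
    ∀ᵐ ω ∂P, ∀ t, 1 ≤ t → x t ω = B (z t ω) + v t ω :=
  ae_all_iff.mpr fun t => by
    by_cases ht : 1 ≤ t
    · filter_upwards [h.first_stage t ht] with ω hω _ using hω
    · exact Eventually.of_forall fun ω ht' => absurd ht' ht

end Model

/-! ### Noise and bias of the two-stage estimator. -/

section Estimator

variable {Ω : Type*} [MeasurableSpace Ω] {H : Type*} [NormedAddCommGroup H]
  [InnerProductSpace ℝ H] [CompleteSpace H] {A B : H →L[ℝ] H}
  {y x z u v : ℕ → Ω → H} {α₁ α₂ : ℕ → ℝ}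

omit [MeasurableSpace Ω] in
theorem norm_sq_f2slse_sub_le (hinf : ¬ FiniteDimensional ℝ H) {T : ℕ} (h₁ : 0 < α₁ T)
    (h₂ : 0 < α₂ T) {ω : Ω} (h : ∀ t, 1 ≤ t → y t ω = A (x t ω) + u t ω) :
    ‖f2slse y x z α₁ α₂ T ω - A ∘L tildeProj x z α₁ α₂ T ω‖ ^ 2 ≤
      ‖sampleOp u z T ω‖ ^ 2 * ((√(α₁ T))⁻¹ * (√(α₂ T))⁻¹) := by
  have hD := isEigenSystem_sampleOp hinf z T ω
  have hQ : IsEigenSystem (hatQ x z α₁ T ω) (eigval (hatQ x z α₁ T ω))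
      (eigvec (hatQ x z α₁ T ω)) :=
    isEigenSystem_sandwich_regInv hinf hD (sampleOp x z T ω) (K₁ z α₁ T ω)
  -- The systematic part of `P̂` is exactly `A Q̂`; after composition with the regularized inverse
  -- it becomes `A Π̃` and cancels.
  have hP : hatP y x z α₁ T ω = A ∘L hatQ x z α₁ T ω +
      ContinuousLinearMap.adjoint (sampleOp u z T ω) ∘L
        regInv (sampleOp z z T ω) (K₁ z α₁ T ω) ∘L sampleOp x z T ω := by
    rw [hatP, sampleOp_eq_comp_adjoint_add z h, map_add, ContinuousLinearMap.adjoint_comp,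
      ContinuousLinearMap.adjoint_adjoint, ContinuousLinearMap.add_comp, hatQ]
    rfl
  have hA : f2slse y x z α₁ α₂ T ω - A ∘L tildeProj x z α₁ α₂ T ω =
      ContinuousLinearMap.adjoint (sampleOp u z T ω) ∘L
        regInv (sampleOp z z T ω) (K₁ z α₁ T ω) ∘L sampleOp x z T ω ∘L
          regInv (hatQ x z α₁ T ω) (K₂ x z α₁ α₂ T ω) := by
    have hproj : tildeProj x z α₁ α₂ T ω =
        hatQ x z α₁ T ω ∘L regInv (hatQ x z α₁ T ω) (K₂ x z α₁ α₂ T ω) :=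
      (comp_regInv hQ h₂).symm
    rw [f2slse, hP, hproj, ContinuousLinearMap.add_comp, ContinuousLinearMap.comp_assoc,
      add_sub_cancel_left]
    rfl
  rw [hA]
  exact norm_sq_noise_le _ h₁ h₂ hD hQ rfl

theorem tendsto_noise_rate (hα₁ : ∀ T, 0 < α₁ T) (hα₂ : ∀ T, 0 < α₂ T)
    (hratio : Tendsto (fun T => α₁ T / α₂ T) atTop (𝓝 0))
    (hT : Tendsto (fun T : ℕ => (T : ℝ)⁻¹ * (α₁ T)⁻¹) atTop (𝓝 0)) :
    Tendsto (fun T : ℕ => (T : ℝ)⁻¹ * (√(α₁ T))⁻¹ * (√(α₂ T))⁻¹) atTop (𝓝 0) := by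
  -- The rate factors as `(T⁻¹ α₁⁻¹) √(α₁ / α₂)`.
  have h := hT.mul hratio.sqrt
  rw [Real.sqrt_zero, mul_zero] at h
  refine h.congr fun T => ?_
  have e1 := Real.sqrt_pos.mpr (hα₁ T)
  have e2 := Real.sqrt_pos.mpr (hα₂ T)
  rw [Real.sqrt_div (hα₁ T).le]
  nth_rewrite 1 [← Real.mul_self_sqrt (hα₁ T).le]
  field_simp

theorem tendsto_first_stage_rate (hα₁ : ∀ T, 0 < α₁ T) (hlim : Tendsto α₁ atTop (𝓝 0))
    (hT : Tendsto (fun T : ℕ => (T : ℝ)⁻¹ * (α₁ T)⁻¹) atTop (𝓝 0)) :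
    Tendsto (fun T : ℕ => (T : ℝ)⁻¹ * (√(α₁ T))⁻¹) atTop (𝓝 0) := by
  -- The rate factors as `(T⁻¹ α₁⁻¹) √α₁`.
  have h := hT.mul hlim.sqrt
  rw [Real.sqrt_zero, mul_zero] at h
  refine h.congr fun T => ?_
  have e1 := Real.sqrt_pos.mpr (hα₁ T)
  nth_rewrite 1 [← Real.mul_self_sqrt (hα₁ T).le]
  field_simp

theorem tendsto_inv_sqrt_nat : Tendsto (fun T : ℕ => (√(T : ℝ))⁻¹) atTop (𝓝 0) :=
  tendsto_inv_atTop_zero.comp (Real.tendsto_sqrt_atTop.comp tendsto_natCast_atTop_atTop)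

theorem enorm_le_ofReal {E : Type*} [SeminormedAddCommGroup E] {a : E} {c : ℝ} (h : ‖a‖ ≤ c) :
    ‖a‖ₑ ≤ ENNReal.ofReal c := by
  rw [← ofReal_norm]; exact ENNReal.ofReal_le_ofReal h

variable {P : Measure Ω}

/-- The sample operator `Q̂` is consistent for `Q` in operator norm. -/
theorem Assumptions.isLittleOpOne_hatQ_sub [MeasurableSpace H] [IsProbabilityMeasure P]
    (hm : Assumptions P A B y x z u v) (hinf : ¬ FiniteDimensional ℝ H)
    (hα₁ : ∀ T, 0 < α₁ T) (hlim : Tendsto α₁ atTop (𝓝 0))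
    (hT : Tendsto (fun T : ℕ => (T : ℝ)⁻¹ * (α₁ T)⁻¹) atTop (𝓝 0)) :
    IsLittleOpOne P fun T ω => ‖hatQ x z α₁ T ω - popQ P x z‖ₑ := by
  have hsqrt : Tendsto (fun T => √(α₁ T)) atTop (𝓝 0) := by simpa using hlim.sqrt
  have hzz : IsLittleOpOne P fun T ω => ‖sampleOp z z T ω - popCzz P z‖ₑ :=
    (hm.rate_zz.isLittleOpOne tendsto_inv_sqrt_nat).mono
      (Eventually.of_forall fun T => Eventually.of_forall fun ω => enorm_le_hsNorm _)
  have hvzO : IsBigOp P (fun T ω => ‖sampleOp v z T ω‖ₑ) fun T => (√(T : ℝ))⁻¹ :=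
    hm.rate_vz.mono
      (Eventually.of_forall fun T => Eventually.of_forall fun ω => enorm_le_hsNorm _)
  have hvz := hvzO.isLittleOpOne tendsto_inv_sqrt_nat
  -- The quadratic error term is of order `T⁻¹ α₁^{-1/2}`, the only place where the inverse could
  -- amplify the first-stage error.
  have hvz2 := (hvzO.sq_mul (fun T => by positivity) fun T => (√(α₁ T))⁻¹).isLittleOpOne
    ((tendsto_first_stage_rate hα₁ hlim hT).congr fun T => by
      rw [inv_pow, Real.sq_sqrt (Nat.cast_nonneg T)])
  have hsum := (((hzz.add (isLittleOpOne_ofReal P hsqrt)).const_mul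
    (c := ENNReal.ofReal (‖B‖ ^ 2)) ENNReal.ofReal_ne_top).add
      (hvz.const_mul (c := ENNReal.ofReal (2 * ‖B‖)) ENNReal.ofReal_ne_top)).add hvz2
  refine hsum.mono (Eventually.of_forall fun T => ?_)
  filter_upwards [hm.ae_first_stage] with ω hω
  have h1 := norm_sandwich_sub_le (popCzz P z) B (sampleOp v z T ω) (hα₁ T)
    (isEigenSystem_sampleOp hinf z T ω) (adjoint_sampleOp z z T ω)
  rw [← sampleOp_eq_comp_adjoint_add z hω, ← hm.popQ_eq hinf] at h1
  refine (enorm_le_ofReal h1).trans_eq ?_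
  rw [ENNReal.ofReal_add (by positivity) (by positivity),
    ENNReal.ofReal_add (by positivity) (by positivity), ENNReal.ofReal_mul (by positivity),
    ENNReal.ofReal_add (by positivity) (by positivity),
    ENNReal.ofReal_mul (p := 2 * ‖B‖) (by positivity),
    ENNReal.ofReal_mul (p := ‖sampleOp v z T ω‖ ^ 2) (by positivity),
    ENNReal.ofReal_pow (norm_nonneg (sampleOp v z T ω)), ofReal_norm, ofReal_norm]

/-- The discarded directions are asymptotically negligible for a Hilbert-Schmidt operator. -/
theorem isLittleOpOne_comp_id_sub_tildeProj {Q : H →L[ℝ] H} (hinf : ¬ FiniteDimensional ℝ H)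
    (hA : hsNorm A < ∞) (hsa : IsSelfAdjoint Q) (hker : Q.ker = ⊥)
    (hQ : IsLittleOpOne P fun T ω => ‖hatQ x z α₁ T ω - Q‖ₑ)
    (hα₂ : ∀ T, 0 < α₂ T) (hlim : Tendsto α₂ atTop (𝓝 0)) :
    IsLittleOpOne P fun T ω =>
      ‖A ∘L (ContinuousLinearMap.id ℝ H - tildeProj x z α₁ α₂ T ω)‖ₑ := by
  refine isLittleOpOne_of_forall_le_add fun δ hδ => ?_
  -- Half of `δ`, since the approximation error enters with the factor `2` bounding `‖I - Π̃‖`. The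
  -- operator `G` is fixed before `T` grows, so its possibly large norm is harmless.
  obtain ⟨G, hG⟩ := exists_norm_sub_comp_le hA hsa hker (half_pos hδ)
  have hsqrt : Tendsto (fun T => √(α₂ T)) atTop (𝓝 0) := by simpa using hlim.sqrt
  refine ⟨_, ((hQ.const_mul (c := ENNReal.ofReal 2) ENNReal.ofReal_ne_top).add
    (isLittleOpOne_ofReal P hsqrt)).const_mul (c := ENNReal.ofReal ‖G‖) ENNReal.ofReal_ne_top,
    fun T ω => ?_⟩
  have hS : IsEigenSystem (hatQ x z α₁ T ω) (eigval (hatQ x z α₁ T ω))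
      (eigvec (hatQ x z α₁ T ω)) :=
    isEigenSystem_sandwich_regInv hinf (isEigenSystem_sampleOp hinf z T ω) (sampleOp x z T ω)
      (K₁ z α₁ T ω)
  have h1 := norm_comp_id_sub_eigProj_le A G Q (hα₂ T) hS
  have h2 : ‖A ∘L (ContinuousLinearMap.id ℝ H - tildeProj x z α₁ α₂ T ω)‖ ≤
      δ + ‖G‖ * (2 * ‖hatQ x z α₁ T ω - Q‖ + √(α₂ T)) :=
    h1.trans (by linarith)
  refine (enorm_le_ofReal h2).trans_eq ?_
  rw [ENNReal.ofReal_add (by positivity) (by positivity), ENNReal.ofReal_mul (by positivity),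
    ENNReal.ofReal_add (by positivity) (by positivity), ENNReal.ofReal_mul (by positivity),
    ofReal_norm (hatQ x z α₁ T ω - Q)]

end Estimator

end F2SLS

end

theorem theorem5 {Ω : Type*} [MeasurableSpace Ω] {H : Type*} [NormedAddCommGroup H]
    [InnerProductSpace ℝ H] [CompleteSpace H] [SecondCountableTopology H] [MeasurableSpace H]
    [BorelSpace H] (hinf : ¬ FiniteDimensional ℝ H) (P : Measure Ω) [IsProbabilityMeasure P]
    (A B : H →L[ℝ] H) (y x z u v : ℕ → Ω → H) (hmodel : F2SLS.Assumptions P A B y x z u v)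
    (α₁ α₂ : ℕ → ℝ) (hα₁ : ∀ T, 0 < α₁ T) (hα₂ : ∀ T, 0 < α₂ T)
    (hα₁_lim : Tendsto α₁ atTop (𝓝 0)) (hα₂_lim : Tendsto α₂ atTop (𝓝 0))
    (hα_ratio : Tendsto (fun T => α₁ T / α₂ T) atTop (𝓝 0))
    (hα₁_T : Tendsto (fun T : ℕ => (T : ℝ)⁻¹ * (α₁ T)⁻¹) atTop (𝓝 0))
    (hgap : F2SLS.IsLittleOpOne P fun T ω => ‖(√(T : ℝ))⁻¹ *
      (∑ j ∈ Finset.range (F2SLS.K₁ z α₁ T ω), F2SLS.eigval (F2SLS.popCzz P z) j *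
        F2SLS.gapConst (F2SLS.eigval (F2SLS.popCzz P z)) j) *
      (∑ j ∈ Finset.range (F2SLS.K₂ x z α₁ α₂ T ω),
        F2SLS.gapConst (F2SLS.eigval (F2SLS.popQ P x z)) j)‖ₑ)
    (htail : F2SLS.IsLittleOpOne P fun T ω =>
      ‖(∑' j, F2SLS.eigval (F2SLS.popCzz P z) (F2SLS.K₁ z α₁ T ω + j)) *
      (∑ j ∈ Finset.range (F2SLS.K₂ x z α₁ α₂ T ω),
        F2SLS.gapConst (F2SLS.eigval (F2SLS.popQ P x z)) j)‖ₑ) :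
    F2SLS.IsBigOp P (fun T ω => ‖F2SLS.f2slse y x z α₁ α₂ T ω -
        A ∘L F2SLS.tildeProj x z α₁ α₂ T ω‖ₑ ^ 2)
      (fun T => (T : ℝ)⁻¹ * (√(α₁ T))⁻¹ * (√(α₂ T))⁻¹) ∧
    F2SLS.IsLittleOpOne P (fun T ω =>
      ‖A ∘L (ContinuousLinearMap.id ℝ H - F2SLS.tildeProj x z α₁ α₂ T ω)‖ₑ ^ 2) ∧
    F2SLS.IsLittleOpOne P (fun T ω => ‖F2SLS.f2slse y x z α₁ α₂ T ω - A‖ₑ) := by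
  have hQ := hmodel.isLittleOpOne_hatQ_sub hinf hα₁ hα₁_lim hα₁_T
  have hpos : (F2SLS.popQ P x z).IsPositive := by
    rw [hmodel.popQ_eq hinf]
    exact (F2SLS.isPositive_momentOp_self (hmodel.sq_integrable_z 1 le_rfl)).conj_adjoint B
  have hbias := F2SLS.isLittleOpOne_comp_id_sub_tildeProj hinf hmodel.hilbertSchmidt
    hpos.isSelfAdjoint hmodel.ker_Q hQ hα₂ hα₂_lim
  have huz : F2SLS.IsBigOp P (fun T ω => ‖F2SLS.sampleOp u z T ω‖ₑ)
      fun T => (√(T : ℝ))⁻¹ := by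
    refine hmodel.rate_uz.mono (Eventually.of_forall fun T => Eventually.of_forall fun ω => ?_)
    -- Exogeneity removes the centering, so the assumed rate bounds the sample operator itself.
    rw [hmodel.momentOp_uz, sub_zero]
    exact F2SLS.enorm_le_hsNorm _
  have hnoise : F2SLS.IsBigOp P (fun T ω => ‖F2SLS.f2slse y x z α₁ α₂ T ω -
      A ∘L F2SLS.tildeProj x z α₁ α₂ T ω‖ₑ ^ 2)
      (fun T => (T : ℝ)⁻¹ * (√(α₁ T))⁻¹ * (√(α₂ T))⁻¹) := by
    have h1 := (huz.sq_mul (fun T => by positivity)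
      (fun T => (√(α₁ T))⁻¹ * (√(α₂ T))⁻¹)).mono (X := fun T ω => ‖F2SLS.f2slse y x z α₁ α₂ T ω -
        A ∘L F2SLS.tildeProj x z α₁ α₂ T ω‖ₑ ^ 2) <| Eventually.of_forall fun T => by
      filter_upwards [hmodel.ae_model] with ω hω
      have h2 := ENNReal.ofReal_le_ofReal
        (F2SLS.norm_sq_f2slse_sub_le (z := z) hinf (hα₁ T) (hα₂ T) hω)
      rwa [ENNReal.ofReal_mul (by positivity), ENNReal.ofReal_pow (norm_nonneg _),
        ENNReal.ofReal_pow (norm_nonneg _), ofReal_norm, ofReal_norm] at h2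
    convert h1 using 2 with T
    rw [inv_pow, Real.sq_sqrt (Nat.cast_nonneg T), mul_assoc]
  refine ⟨hnoise, hbias.sq, ?_⟩
  have hnoise0 := (hnoise.isLittleOpOne
    (F2SLS.tendsto_noise_rate hα₁ hα₂ hα_ratio hα₁_T)).of_sq
  refine (hnoise0.add hbias).mono (Eventually.of_forall fun T => Eventually.of_forall fun ω => ?_)
  -- Noise minus truncation bias; each part vanishes in probability.
  have h1 : F2SLS.f2slse y x z α₁ α₂ T ω - A =
      (F2SLS.f2slse y x z α₁ α₂ T ω - A ∘L F2SLS.tildeProj x z α₁ α₂ T ω) -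
        A ∘L (ContinuousLinearMap.id ℝ H - F2SLS.tildeProj x z α₁ α₂ T ω) := by
    rw [ContinuousLinearMap.comp_sub, ContinuousLinearMap.comp_id]
    abel
  rw [h1]
  exact enorm_sub_le
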